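/- A source transmits with power $P>0$ to a destination $D$ via a reconfigurable surface with $L\ge 1$ reflecting elements (no direct link). The noise variance is $\sigma^2>0$, the path-loss exponent is $\delta>0$, the distance from the source to the surface is a fixed $d_{SR}>0$, and the destination is uniformly distributed in the planar ring with inner radius $R_1$ and outer radius $R_2$, $0<R_1<R_2$, centered at the surface; $d_{RD}$ denotes its distance from the surface. The fading amplitudes $\mathfrak h_l,\mathfrak g_l$ ($1\le l\le L$) are Rayleigh distributed with unit scale parameter (density $xe^{-x^2/2}$ on $x\ge 0$), the phase errors $\epsilon_l$ are uniform on $(-\pi,\pi)$, and all these variables and the position of the destination are independent. Put $\bar\gamma=\dfrac{P}{\sigma^2 d_{SR}^{\delta}}$ and $$\gamma_D=\frac{P}{\sigma^2 d_{SR}^{\delta}\,d_{RD}^{\delta}}\Big|\sum_{l=1}^{L}\mathfrak h_l\,\mathfrak g_l\,e^{j\epsilon_l}\Big|^2,\qquad j=\sqrt{-1}.$$ Let $\theta,T,B>0$ (decay rate of the buffer occupancy, block length, bandwidth), $A=\theta TB/\ln 2$, and define the effective rate $\mathcal R=-\frac1A\log_2\mathbb E\big[(1+\gamma_D)^{-A}\big]$.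 Then $$\mathcal R=-\frac1A\log_2\left[\frac{\mathcal W}{2\delta\,\bar\gamma\,\Gamma(L)\,\Gamma(A)\,(R_2^2-R_1^2)}\right],$$ where $$\mathcal W=R_2^{2+\delta}\,G_{2,4}^{3,2}\!\left[\frac{R_2^{\delta}}{4\bar\gamma}\,\middle|\begin{array}{c}-\frac2\delta,\,0\\ L-1,\,0,\,A-1,\,-1-\frac2\delta\end{array}\right]-R_1^{2+\delta}\,G_{2,4}^{3,2}\!\left[\frac{R_1^{\delta}}{4\bar\gamma}\,\middle|\begin{array}{c}-\frac2\delta,\,0\\ L-1,\,0,\,A-1,\,-1-\frac2\delta\end{array}\right].$$ Here $G_{p,q}^{m,n}$ is Meijer's function $$G_{p,q}^{m,n}\!\left[z\,\middle|\begin{array}{c}a_1,\dots,a_p\\ b_1,\dots,b_q\end{array}\right]=\frac1{2\pi i}\int\frac{\prod_{j=1}^m\Gamma(b_j-s)\prod_{j=1}^n\Gamma(1-a_j+s)}{\prod_{j=m+1}^q\Gamma(1-b_j+s)\prod_{j=n+1}^p\Gamma(a_j-s)}\,z^s\,ds ,$$ the integral being taken upwards along a vertical line that separates the poles of the $\Gamma(b_j-s)$,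 $j\le m$ (on its right), from those of the $\Gamma(1-a_j+s)$, $j\le n$ (on its left). For the parameters above such lines exist, the integrals converge absolutely and do not depend on the choice of the line, $\mathcal W$ is real, and the argument of the logarithm is positive. -/

import Mathlib

open MeasureTheory ProbabilityTheory

noncomputable section

/-- The density of the Rayleigh distribution with scale parameter `s`. -/
def rayleighPDFReal (s x : ℝ) : ℝ :=
  if 0 ≤ x then x / s ^ 2 * Real.exp (-x ^ 2 / (2 * s ^ 2)) else 0

/-- The Rayleigh distribution on `ℝ` with scale parameter `s`. -/
def rayleighMeasure (s : ℝ) : Measure ℝ :=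
  volume.withDensity fun x => ENNReal.ofReal (rayleighPDFReal s x)

/-- The ring (closed annulus) with center `O`, inner radius `R₁` and outer radius `R₂`
in the Euclidean plane. -/
def planarRing (O : EuclideanSpace ℝ (Fin 2)) (R₁ R₂ : ℝ) : Set (EuclideanSpace ℝ (Fin 2)) :=
  {x | R₁ ≤ dist O x ∧ dist O x ≤ R₂}

/-- The instantaneous signal-to-noise ratio at the destination of a link reflected by a surface with
`L` elements: transmit power `P`, noise variance `σ ^ 2`, path-loss exponent `δ`, distances `dSR`
(source to surface) and `dRD` (surface to destination), fading amplitudes `h l`, `g l` and phase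
errors `ε l`. -/
def snr {L : ℕ} (P σ δ dSR dRD : ℝ) (h g ε : Fin L → ℝ) : ℝ :=
  P / (dSR ^ δ * dRD ^ δ * σ ^ 2) *
    ‖∑ l, ((h l : ℂ) * (g l : ℂ) * Complex.exp (Complex.I * (ε l : ℂ)))‖ ^ 2

/-- The effective rate `-(1 / A) log₂ E[(1 + γ) ^ (-A)]` of a random signal-to-noise ratio `γ`. -/
def effectiveRate {Ω : Type*} [MeasurableSpace Ω] (μ : Measure Ω) (A : ℝ) (γ : Ω → ℝ) : ℝ :=
  -(1 / A) * Real.logb 2 (∫ ω, (1 + γ ω) ^ (-A) ∂μ)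

/-- The Mellin-Barnes integrand of the Meijer function `G_{p,q}^{m,n}` with upper parameters
`a` and lower parameters `b` (`0 ≤ m ≤ q`, `0 ≤ n ≤ p`):
`∏_{j ≤ m} Γ(b_j - s) ∏_{j ≤ n} Γ(1 - a_j + s) /
  (∏_{m < j ≤ q} Γ(1 - b_j + s) ∏_{n < j ≤ p} Γ(a_j - s)) * z ^ s`.
The indices of `Fin` start at `0`, so `j ≤ m` becomes `j < m`. -/
def meijerIntegrand {p q : ℕ} (m n : ℕ) (a : Fin p → ℂ) (b : Fin q → ℂ) (z s : ℂ) : ℂ :=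
  ((∏ j : Fin q with j.val < m, Complex.Gamma (b j - s)) *
      (∏ j : Fin p with j.val < n, Complex.Gamma (1 - a j + s))) /
    ((∏ j : Fin q with m ≤ j.val, Complex.Gamma (1 - b j + s)) *
      (∏ j : Fin p with n ≤ j.val, Complex.Gamma (a j - s))) * z ^ s

/-- The vertical line `Re s = c` separates the poles `b_j + k` (`j ≤ m`) of the factors
`Γ(b_j - s)`, which lie to its right, from the poles `a_j - 1 - k` (`j ≤ n`) of the factors
`Γ(1 - a_j + s)`, which lie to its left. -/
def SeparatesPoles {p q : ℕ} (m n : ℕ) (a : Fin p → ℂ) (b : Fin q → ℂ) (c : ℝ) : Prop :=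
  (∀ j : Fin q, j.val < m → ∀ k : ℕ, c < (b j + k).re) ∧
    (∀ j : Fin p, j.val < n → ∀ k : ℕ, (a j - 1 - k).re < c)

/-- `w` is the value of Meijer's function `G_{p,q}^{m,n}` with parameters `a ; b` at `z`, given by
the Mellin-Barnes integral `(1 / (2πi)) ∫ … ds` along a vertical line, run upwards, that separates
the two families of poles: such a line exists, and along each such line the integral converges
absolutely and has the value `w`. (With `s = c + i t`, `ds = i dt`.) -/
def IsMeijerG {p q : ℕ} (m n : ℕ) (a : Fin p → ℂ) (b : Fin q → ℂ) (z w : ℂ) : Prop :=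
  m ≤ q ∧ n ≤ p ∧ z ≠ 0 ∧ (∃ c : ℝ, SeparatesPoles m n a b c) ∧
    ∀ c : ℝ, SeparatesPoles m n a b c →
      Integrable (fun t : ℝ => meijerIntegrand m n a b z (c + t * Complex.I)) ∧
      (1 / (2 * Real.pi) : ℂ) * ∫ t : ℝ, meijerIntegrand m n a b z (c + t * Complex.I) = w

open Classical in
/-- Meijer's function `G_{p,q}^{m,n}` with parameters `a ; b` at `z`, for parameters whose two
families of poles can be separated by a vertical line (and `0` where the integral does not
define it). -/
def meijerG {p q : ℕ} (m n : ℕ) (a : Fin p → ℂ) (b : Fin q → ℂ) (z : ℂ) : ℂ :=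
  if h : ∃ w, IsMeijerG m n a b z w then h.choose else 0

end

/-! ### Gamma and Rayleigh laws. -/

noncomputable section

/-! The expectation is rewritten as a Laplace transform of a product of independent variables, whose
Mellin transform is a product of Gamma factors; Mellin inversion then is the Meijer integral.

Gain: a Rayleigh radius with uniform phase is a standard complex Gaussian, so each `h g e^{jε}` is a
Gaussian with random scale and has characteristic function `1 / (1 + |t|²)`. The sum has `(1 +
|t|²)^(-L)`, which is also the characteristic function of a Gaussian scaled by `√(2X)` with `X ∼
Γ(L)`. Hence the squared modulus has the law of `4XY` with `Y ∼ Γ(1)` independent of `X`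
(`map_norm_sq_reflectedSum_pi`).

Position: the squared distance is uniform on `(R₁², R₂²)`, so the mean is a difference of integrals
over `(0, R²)`, and there `v = R² u` with `u` uniform on `(0, 1)`. Since `(1 + y)^(-A) = E exp(-G
y)` for `G ∼ Γ(A)`, each integral is `R² E exp(-V / z)` with `V = G X Y u^(-δ/2)` and `z = R^δ /
(4γ)` (`integral_exp_neg_mixedProduct`).

Mellin side: `exp(-V y)` has Mellin transform `Γ(s) V^(-s)`, and `E V^(-s)` is `Γ(A-s) Γ(L-s) Γ(1-s)
/ (Γ(A) Γ(L) (1 + δs/2))`. The rational factor is a quotient of two Gamma values, and the shift `s ↦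
s - 1` produces the stated parameters (`isMeijerG_laplace`). -/

theorem integral_gammaMeasure {E : Type*} [NormedAddCommGroup E] [NormedSpace ℝ E] (a : ℝ)
    (ha : 0 < a) (f : ℝ → E) :
    ∫ x, f x ∂(gammaMeasure a 1) =
      (Real.Gamma a)⁻¹ • ∫ x in Set.Ioi (0 : ℝ), (x ^ (a - 1) * Real.exp (-x)) • f x := by
  have hm : Measurable (gammaPDF a 1) := (measurable_gammaPDFReal a 1).ennreal_ofReal
  rw [gammaMeasure, integral_withDensity_eq_integral_toReal_smul hm
    (Filter.Eventually.of_forall fun x => by simp [gammaPDF]),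
    ← integral_smul, ← integral_indicator measurableSet_Ioi]
  refine integral_congr_ae ?_
  -- The density is supported on `0 ≤ x` and may be nonzero at `0`, whereas the right side lives on
  -- `0 < x`; the two differ on a null set.
  filter_upwards [compl_mem_ae_iff.2 (measure_singleton (0 : ℝ))] with x hx
  simp only [Set.mem_compl_iff, Set.mem_singleton_iff] at hx
  rw [gammaPDF, ENNReal.toReal_ofReal (gammaPDFReal_nonneg ha one_pos x)]
  by_cases h : 0 < x
  · rw [Set.indicator_of_mem (Set.mem_Ioi.2 h), gammaPDFReal, if_pos h.le, smul_smul]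
    congr 1
    simp
    ring
  · rw [Set.indicator_of_notMem (by simpa using h), gammaPDFReal, if_neg, zero_smul]
    exact fun h' => h (lt_of_le_of_ne h' (Ne.symm hx))

theorem ae_pos_gammaMeasure (a : ℝ) : ∀ᵐ x ∂(gammaMeasure a 1), 0 < x := by
  have hm : Measurable (gammaPDF a 1) := (measurable_gammaPDFReal a 1).ennreal_ofReal
  rw [gammaMeasure, ae_withDensity_iff hm]
  filter_upwards [compl_mem_ae_iff.2 (measure_singleton (0 : ℝ))] with x hx h
  simp only [Set.mem_compl_iff, Set.mem_singleton_iff] at hx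
  by_contra h'
  exact h (gammaPDF_of_neg (lt_of_le_of_ne (not_lt.1 h') hx))

theorem integral_cpow_neg_gammaMeasure {a : ℝ} (ha : 0 < a) {s : ℂ} (hs : s.re < a) :
    ∫ x, (x : ℂ) ^ (-s) ∂(gammaMeasure a 1) = Complex.Gamma (a - s) / Complex.Gamma a := by
  have h := Complex.integral_cpow_mul_exp_neg_mul_Ioi (a := (a : ℂ) - s) (r := 1)
    (by simpa using hs) one_pos
  rw [integral_gammaMeasure a ha]
  simp only [Complex.ofReal_one, div_one, Complex.one_cpow, one_mul] at h
  rw [← h, Complex.real_smul, Complex.ofReal_inv, Complex.Gamma_ofReal, div_eq_inv_mul]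
  congr 1
  refine setIntegral_congr_fun measurableSet_Ioi fun x hx => ?_
  have hx' : (x : ℂ) ≠ 0 := by exact_mod_cast (ne_of_gt hx)
  simp only [Complex.real_smul, Complex.ofReal_mul, Complex.ofReal_exp, Complex.ofReal_neg]
  rw [Complex.ofReal_cpow (le_of_lt hx), show (a : ℂ) - s - 1 = (a - 1) + (-s) by ring,
    Complex.cpow_add _ _ hx']
  push_cast
  ring

/-- Used in two roles: it turns the power `-A` into an exponential, and it evaluates the
characteristic functions of the Gaussian mixtures. -/
theorem integral_exp_neg_mul_gammaMeasure {a : ℝ} (ha : 0 < a) {y : ℝ} (hy : 0 ≤ y) :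
    ∫ x, Real.exp (-(x * y)) ∂(gammaMeasure a 1) = (1 + y) ^ (-a) := by
  have h := Real.integral_rpow_mul_exp_neg_mul_Ioi (a := a) (r := 1 + y) ha (by positivity)
  rw [integral_gammaMeasure a ha]
  simp only [smul_eq_mul]
  have : ∫ x in Set.Ioi (0 : ℝ), x ^ (a - 1) * Real.exp (-x) * Real.exp (-(x * y)) =
      ∫ x in Set.Ioi (0 : ℝ), x ^ (a - 1) * Real.exp (-((1 + y) * x)) := by
    congr 1
    ext x
    rw [mul_assoc, ← Real.exp_add]
    ring_nf
  rw [this, h, one_div, Real.inv_rpow (by positivity), Real.rpow_neg (by positivity)]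
  field_simp [(Real.Gamma_pos_of_pos ha).ne']

theorem measurable_rayleighPDFReal (s : ℝ) : Measurable (rayleighPDFReal s) :=
  Measurable.ite measurableSet_Ici (by fun_prop) measurable_const

theorem rayleighPDFReal_nonneg (s x : ℝ) : 0 ≤ rayleighPDFReal s x := by
  rw [rayleighPDFReal]
  split_ifs <;> positivity

theorem integral_rayleighMeasure_one {E : Type*} [NormedAddCommGroup E] [NormedSpace ℝ E]
    (f : ℝ → E) :
    ∫ x, f x ∂(rayleighMeasure 1) =
      ∫ x in Set.Ioi (0 : ℝ), (x * Real.exp (-x ^ 2 / 2)) • f x := by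
  rw [rayleighMeasure, integral_withDensity_eq_integral_toReal_smul
    (measurable_rayleighPDFReal 1).ennreal_ofReal
    (Filter.Eventually.of_forall fun x => by simp),
    ← integral_indicator measurableSet_Ioi]
  congr 1
  ext x
  rw [ENNReal.toReal_ofReal (rayleighPDFReal_nonneg 1 x)]
  by_cases h : 0 < x
  · rw [Set.indicator_of_mem (Set.mem_Ioi.2 h), rayleighPDFReal, if_pos h.le]
    simp
  · rw [Set.indicator_of_notMem (by simpa using h), rayleighPDFReal]
    split_ifs with h'
    · simp [le_antisymm (not_lt.1 h) h']
    · simp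

/-- Substitution `y = x² / 2`. No regularity of `f` is needed, so constants give total mass one and
indicators give the image law. -/
theorem integral_sq_div_two_rayleighMeasure_one {E : Type*} [NormedAddCommGroup E]
    [NormedSpace ℝ E] (f : ℝ → E) :
    ∫ x, f (x ^ 2 / 2) ∂(rayleighMeasure 1) = ∫ x, f x ∂(gammaMeasure 1 1) := by
  rw [integral_rayleighMeasure_one, integral_gammaMeasure 1 one_pos]
  have h1 := integral_comp_rpow_Ioi_of_pos (p := 2)
    (g := fun y : ℝ => (1 / 2 * Real.exp (-(y / 2))) • f (y / 2)) two_pos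
  have h2 := integral_comp_mul_left_Ioi (fun y : ℝ => (Real.exp (-y)) • f y) 0
    (b := 1 / 2) (by norm_num)
  simp only [mul_zero] at h2
  simp only [Real.Gamma_one, inv_one, one_smul, sub_self, Real.rpow_zero, one_mul]
  have h3 : ∫ y in Set.Ioi (0 : ℝ), Real.exp (-y) • f y =
      (1 / 2 : ℝ) • ∫ y in Set.Ioi (0 : ℝ), Real.exp (-(1 / 2 * y)) • f (1 / 2 * y) := by
    rw [h2, smul_smul]; norm_num
  rw [h3, ← integral_smul]
  calc _ = ∫ x in Set.Ioi (0 : ℝ), (2 * x ^ ((2 : ℝ) - 1)) •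
        (1 / 2 * Real.exp (-(x ^ (2 : ℝ) / 2))) • f (x ^ (2 : ℝ) / 2) := by
        refine setIntegral_congr_fun measurableSet_Ioi fun x hx => ?_
        simp only [smul_smul]
        norm_num
        congr 1
        ring_nf
    _ = _ := h1
    _ = _ := by
        congr 1
        ext y
        rw [smul_smul, show y / 2 = 1 / 2 * y by ring]

instance isProbabilityMeasure_rayleighMeasure_one :
    IsProbabilityMeasure (rayleighMeasure 1) := by
  have := isProbabilityMeasure_gammaMeasure (a := 1) (r := 1) one_pos one_pos
  have h := integral_sq_div_two_rayleighMeasure_one (fun _ => (1 : ℝ))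
  constructor
  simpa [Measure.real, ENNReal.toReal_eq_one_iff] using h

theorem map_sq_div_two_rayleighMeasure_one :
    (rayleighMeasure 1).map (fun x => x ^ 2 / 2) = gammaMeasure 1 1 := by
  have := isProbabilityMeasure_gammaMeasure (a := 1) (r := 1) one_pos one_pos
  have hm : Measurable fun x : ℝ => x ^ 2 / 2 := by fun_prop
  have := Measure.isProbabilityMeasure_map (μ := rayleighMeasure 1) hm.aemeasurable
  ext s hs
  rw [← ENNReal.toReal_eq_toReal_iff' (measure_ne_top _ _) (measure_ne_top _ _)]
  change Measure.real _ s = Measure.real _ s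
  rw [← integral_indicator_one hs, ← integral_indicator_one hs,
    ← integral_sq_div_two_rayleighMeasure_one, integral_map hm.aemeasurable]
  exact ((measurable_one).indicator hs).aestronglyMeasurable

end

/-! ### Laplace transforms and Mellin inversion. -/

noncomputable section

section Laplace

variable {Ω : Type*} [MeasurableSpace Ω] {ν : Measure Ω} {V : Ω → ℝ} {s : ℂ}

theorem norm_cpow_neg_of_pos {x : ℝ} (hx : 0 < x) (s : ℂ) :
    ‖(x : ℂ) ^ (-s)‖ = x ^ (-s.re) := by
  rw [Complex.norm_cpow_eq_rpow_re_of_pos hx, Complex.neg_re]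

theorem integral_Ioi_rpow_mul_exp_neg_mul {c v : ℝ} (hc : 0 < c) (hv : 0 < v) :
    ∫ y in Set.Ioi (0 : ℝ), y ^ (c - 1) * Real.exp (-(v * y)) = v ^ (-c) * Real.Gamma c := by
  rw [Real.integral_rpow_mul_exp_neg_mul_Ioi hc hv, one_div, Real.inv_rpow hv.le,
    Real.rpow_neg hv.le]

theorem integrableOn_Ioi_cpow_mul_exp_neg_mul (hs : 0 < s.re) {v : ℝ} (hv : 0 < v) :
    IntegrableOn (fun y : ℝ => (y : ℂ) ^ (s - 1) * Complex.exp (-(v * y))) (Set.Ioi 0) := by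
  -- A non-integrable function has integral `0` by convention, so a known nonzero value proves
  -- integrability.
  refine Integrable.of_integral_ne_zero ?_
  rw [Complex.integral_cpow_mul_exp_neg_mul_Ioi hs hv]
  refine mul_ne_zero ?_ (Complex.Gamma_ne_zero_of_re_pos hs)
  rw [Ne, Complex.cpow_eq_zero_iff]
  simp [hv.ne']

/-- Tonelli: for fixed `ω` the norm integrates over `y` to `Γ(Re s) V^(-Re s)`, which is integrable
by `hint`. This licenses the exchange of integrals in `hasMellin_laplace`. -/
theorem integrable_prod_cpow_mul_exp_neg_mul [IsFiniteMeasure ν] (hVm : Measurable V)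
    (hV : ∀ᵐ ω ∂ν, 0 < V ω) (hs : 0 < s.re) (hint : Integrable (fun ω => (V ω : ℂ) ^ (-s)) ν) :
    Integrable (fun p : ℝ × Ω => (p.1 : ℂ) ^ (s - 1) * Complex.exp (-(V p.2 * p.1)))
      ((volume.restrict (Set.Ioi 0)).prod ν) := by
  have hm : Measurable (fun p : ℝ × Ω => (p.1 : ℂ) ^ (s - 1) * Complex.exp (-(V p.2 * p.1))) := by
    fun_prop
  rw [integrable_prod_iff' hm.aestronglyMeasurable]
  refine ⟨?_, ?_⟩
  · filter_upwards [hV] with ω hω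
    exact integrableOn_Ioi_cpow_mul_exp_neg_mul hs hω
  · refine (hint.norm.mul_const (Real.Gamma s.re)).congr ?_
    filter_upwards [hV] with ω hω
    rw [norm_cpow_neg_of_pos hω, ← integral_Ioi_rpow_mul_exp_neg_mul hs hω]
    refine setIntegral_congr_fun measurableSet_Ioi fun y hy => ?_
    simp only [norm_mul]
    rw [Complex.norm_cpow_eq_rpow_re_of_pos hy, Complex.norm_exp]
    simp [← Complex.ofReal_mul]

theorem hasMellin_laplace [IsFiniteMeasure ν] (hVm : Measurable V) (hV : ∀ᵐ ω ∂ν, 0 < V ω)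
    (hs : 0 < s.re) (hint : Integrable (fun ω => (V ω : ℂ) ^ (-s)) ν) :
    HasMellin (fun y : ℝ => ∫ ω, Complex.exp (-(V ω * y)) ∂ν) s
      (Complex.Gamma s * ∫ ω, (V ω : ℂ) ^ (-s) ∂ν) := by
  have hI := integrable_prod_cpow_mul_exp_neg_mul hVm hV hs hint
  refine ⟨?_, ?_⟩
  · have := hI.integral_prod_left
    simpa [MellinConvergent, IntegrableOn, integral_const_mul] using this
  · simp only [mellin, smul_eq_mul]
    simp_rw [← integral_const_mul]
    rw [integral_integral_swap hI]
    refine integral_congr_ae ?_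
    filter_upwards [hV] with ω hω
    rw [Complex.integral_cpow_mul_exp_neg_mul_Ioi hs hω, one_div, Complex.inv_cpow,
      Complex.cpow_neg, mul_comm]
    rw [Complex.arg_ofReal_of_nonneg hω.le]
    exact Real.pi_pos.ne

theorem continuousAt_laplace [IsFiniteMeasure ν] (hVm : Measurable V) (hV : ∀ᵐ ω ∂ν, 0 < V ω)
    {y : ℝ} (hy : 0 < y) :
    ContinuousAt (fun y : ℝ => ∫ ω, Complex.exp (-(V ω * y)) ∂ν) y := by
  refine continuousAt_of_dominated (bound := fun _ => 1) ?_ ?_ (integrable_const _) ?_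
  · exact Filter.Eventually.of_forall fun y => by fun_prop
  · filter_upwards [lt_mem_nhds hy] with y hy
    filter_upwards [hV] with ω hω
    rw [Complex.norm_exp]
    simp only [← Complex.ofReal_mul, ← Complex.ofReal_neg, Complex.ofReal_re, Real.exp_le_one_iff]
    have := mul_pos hω hy
    linarith
  · exact Filter.Eventually.of_forall fun ω => by fun_prop

theorem laplace_eq_integral_vertical [IsFiniteMeasure ν] (hVm : Measurable V)
    (hV : ∀ᵐ ω ∂ν, 0 < V ω) {c : ℝ} (hc : 0 < c)
    (hint : ∀ s : ℂ, s.re = c → Integrable (fun ω => (V ω : ℂ) ^ (-s)) ν)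
    (hvert : Integrable (fun t : ℝ => Complex.Gamma (c + t * Complex.I) *
      ∫ ω, (V ω : ℂ) ^ (-(c + t * Complex.I)) ∂ν))
    {y : ℝ} (hy : 0 < y) :
    (1 / (2 * Real.pi) : ℂ) * ∫ t : ℝ, (y : ℂ) ^ (-(c + t * Complex.I)) *
      (Complex.Gamma (c + t * Complex.I) * ∫ ω, (V ω : ℂ) ^ (-(c + t * Complex.I)) ∂ν) =
      ∫ ω, Complex.exp (-(V ω * y)) ∂ν := by
  have hM : ∀ t : ℝ, mellin (fun y : ℝ => ∫ ω, Complex.exp (-(V ω * y)) ∂ν) (c + t * Complex.I) =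
      Complex.Gamma (c + t * Complex.I) * ∫ ω, (V ω : ℂ) ^ (-(c + t * Complex.I)) ∂ν := fun t =>
    (hasMellin_laplace hVm hV (by simpa using hc) (hint _ (by simp))).2
  have h := mellinInv_mellin_eq c (fun y : ℝ => ∫ ω, Complex.exp (-(V ω * y)) ∂ν) hy
    (hasMellin_laplace hVm hV (by simpa using hc) (hint _ (by simp))).1
    (by simpa only [Complex.VerticalIntegrable, hM] using hvert) (continuousAt_laplace hVm hV hy)
  rw [← h, mellinInv]
  simp only [hM, smul_eq_mul, Complex.real_smul]
  norm_num

end Laplace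

/-! ### The Gamma function on vertical lines. -/

theorem norm_Gamma_le_Gamma_re {s : ℂ} (hs : 0 < s.re) :
    ‖Complex.Gamma s‖ ≤ Real.Gamma s.re := by
  rw [Complex.Gamma_eq_integral hs, Real.Gamma_eq_integral hs, Complex.GammaIntegral]
  refine (norm_integral_le_integral_norm _).trans (le_of_eq ?_)
  refine setIntegral_congr_fun measurableSet_Ioi fun x hx => ?_
  simp only [norm_mul, Complex.norm_real, Real.norm_eq_abs, Real.abs_exp]
  rw [Complex.norm_cpow_eq_rpow_re_of_pos hx]
  simp

/-- The sign `e = ±1` covers both `Γ(s)` and `Γ(1 - s)`, whose arguments run in opposite directions.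
-/
theorem continuous_Gamma_vertical {c : ℝ} (hc : 0 < c) (e : ℝ) :
    Continuous fun t : ℝ => Complex.Gamma (c + e * t * Complex.I) := by
  rw [continuous_iff_continuousAt]
  intro t
  refine ContinuousAt.comp (g := Complex.Gamma)
    (f := fun t : ℝ => (c + e * t * Complex.I : ℂ)) ?_ (by fun_prop)
  refine (Complex.differentiableAt_Gamma _ fun m h => ?_).continuousAt
  have := congrArg Complex.re h
  simp at this
  have hm : (0 : ℝ) ≤ m := m.cast_nonneg
  linarith

theorem sq_mul_one_add_sq_le_norm_sq {x m t : ℝ} (hm : 0 ≤ m) (hm1 : m ≤ 1) (hx : m ≤ x) (y : ℝ)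
    (hy : y ^ 2 = t ^ 2) : m ^ 2 * (1 + t ^ 2) ≤ ‖(x + y * Complex.I : ℂ)‖ ^ 2 := by
  rw [Complex.sq_norm, Complex.normSq_add_mul_I, hy]
  nlinarith [sq_nonneg t, mul_nonneg (mul_nonneg (sub_nonneg.2 hm1) (add_nonneg zero_le_one hm))
    (sq_nonneg t)]

/-- Quadratic decay suffices: in `Γ(s) = Γ(s + 1) / s` and `Γ(1 - s) = Γ(2 - s) / (1 - s)` the
numerators are bounded on the line, and the denominators grow linearly. All other factors of the
Mellin-Barnes integrand will merely be bounded. -/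
theorem integrable_Gamma_mul_Gamma_one_sub_vertical {c : ℝ} (h0 : 0 < c) (h1 : c < 1) :
    Integrable fun t : ℝ =>
      Complex.Gamma (c + t * Complex.I) * Complex.Gamma (1 - (c + t * Complex.I)) := by
  set m := min c (1 - c) with hm
  have hm0 : 0 < m := lt_min h0 (by linarith)
  have hmc : m ≤ c := min_le_left _ _
  have hmc' : m ≤ 1 - c := min_le_right _ _
  have hcont : Continuous fun t : ℝ =>
      Complex.Gamma (c + t * Complex.I) * Complex.Gamma (1 - (c + t * Complex.I)) := by
    have a1 := continuous_Gamma_vertical h0 1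
    have a2 := continuous_Gamma_vertical (sub_pos.2 h1) (-1)
    refine (a1.mul a2).congr fun t => ?_
    simp only [Pi.mul_apply]
    push_cast
    ring_nf
  refine (integrable_inv_one_add_sq.const_mul
    (Real.Gamma (c + 1) * Real.Gamma (1 - c + 1) / m ^ 2)).mono' hcont.aestronglyMeasurable ?_
  refine Filter.Eventually.of_forall fun t => ?_
  set s : ℂ := c + t * Complex.I with hs
  have hs0 : s ≠ 0 := fun h => by simpa [hs, h0.ne'] using congrArg Complex.re h
  have hs1 : 1 - s ≠ 0 := fun h => by
    have := congrArg Complex.re h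
    simp [hs] at this
    linarith
  have hre : s.re = c := by simp [hs]
  have e1 : ‖Complex.Gamma (s + 1)‖ ≤ Real.Gamma (c + 1) := by
    have := norm_Gamma_le_Gamma_re (s := s + 1) (by simp [hre]; linarith)
    simpa [hre] using this
  have e2 : ‖Complex.Gamma (1 - s + 1)‖ ≤ Real.Gamma (1 - c + 1) := by
    have := norm_Gamma_le_Gamma_re (s := 1 - s + 1) (by simp [hre]; linarith)
    simpa [hre] using this
  have n1 : m ^ 2 * (1 + t ^ 2) ≤ ‖s‖ ^ 2 :=
    sq_mul_one_add_sq_le_norm_sq hm0.le (by linarith) hmc t rfl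
  have n2 : m ^ 2 * (1 + t ^ 2) ≤ ‖1 - s‖ ^ 2 := by
    have := sq_mul_one_add_sq_le_norm_sq hm0.le (by linarith) hmc' (-t) (t := t) (by ring)
    convert this using 3
    simp [hs]
    ring
  have n3 : m ^ 2 * (1 + t ^ 2) ≤ ‖s‖ * ‖1 - s‖ := by
    refine (sq_le_sq₀ (by positivity) (by positivity)).1 ?_
    calc (m ^ 2 * (1 + t ^ 2)) ^ 2 = (m ^ 2 * (1 + t ^ 2)) * (m ^ 2 * (1 + t ^ 2)) := by ring
      _ ≤ ‖s‖ ^ 2 * ‖1 - s‖ ^ 2 := by gcongr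
      _ = _ := by ring
  have hG1 : Complex.Gamma s = Complex.Gamma (s + 1) / s := by
    rw [Complex.Gamma_add_one _ hs0]; field_simp
  have hG2 : Complex.Gamma (1 - s) = Complex.Gamma (1 - s + 1) / (1 - s) := by
    rw [Complex.Gamma_add_one _ hs1]; field_simp
  rw [hG1, hG2, norm_mul, norm_div, norm_div, div_mul_div_comm, div_mul_eq_mul_div,
    ← div_eq_mul_inv, div_div]
  rw [mul_comm (1 + t ^ 2)]
  have p1 : 0 ≤ Real.Gamma (c + 1) := (norm_nonneg _).trans e1
  gcongr

end

/-! ### The random product and its negative moments. -/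

noncomputable section

theorem integral_Ioo_cpow_rpow_neg {κ : ℝ} (hκ : 0 < κ) {s : ℂ} (hs : 0 < s.re) :
    ∫ u in Set.Ioo (0 : ℝ) 1, ((u ^ (-κ) : ℝ) : ℂ) ^ (-s) = 1 / (1 + κ * s) := by
  have h : ∫ u in Set.Ioo (0 : ℝ) 1, ((u ^ (-κ) : ℝ) : ℂ) ^ (-s) =
      ∫ u in Set.Ioo (0 : ℝ) 1, (u : ℂ) ^ (κ * s) := by
    refine setIntegral_congr_fun measurableSet_Ioo fun u hu => ?_
    rw [show (κ * s : ℂ) = ((-κ : ℝ) : ℂ) * (-s) by push_cast; ring,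
      Complex.cpow_mul_ofReal_nonneg hu.1.le]
  have hne : κ * s + 1 ≠ 0 := fun h => by
    have := congrArg Complex.re h
    simp at this
    nlinarith [mul_pos hκ hs]
  rw [h, ← integral_Ioc_eq_integral_Ioo, ← intervalIntegral.integral_of_le zero_le_one,
    integral_cpow (Or.inl (by simp; nlinarith [mul_pos hκ hs]))]
  simp [Complex.zero_cpow hne, add_comm]

variable {A ℓ κ : ℝ} {s : ℂ}

/-- The joint law of independent `Γ(A)`, `Γ(ℓ)`, `Γ(1)` and uniform random variables. -/
def gammaUniformMeasure (A ℓ : ℝ) : Measure (ℝ × (ℝ × ℝ) × ℝ) :=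
  (gammaMeasure A 1).prod (((gammaMeasure ℓ 1).prod (gammaMeasure 1 1)).prod
    (volume.restrict (Set.Ioo 0 1)))

/-- The product of three variables with a power of the fourth one. -/
def mixedProduct (κ : ℝ) (p : ℝ × (ℝ × ℝ) × ℝ) : ℝ :=
  p.1 * (p.2.1.1 * p.2.1.2 * p.2.2 ^ (-κ))

theorem measurable_mixedProduct : Measurable (mixedProduct κ) := by
  unfold mixedProduct
  fun_prop

theorem isProbabilityMeasure_gammaUniformMeasure (hA : 0 < A) (hℓ : 0 < ℓ) :
    IsProbabilityMeasure (gammaUniformMeasure A ℓ) := by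
  have := isProbabilityMeasure_gammaMeasure (a := A) (r := 1) hA one_pos
  have := isProbabilityMeasure_gammaMeasure (a := ℓ) (r := 1) hℓ one_pos
  have := isProbabilityMeasure_gammaMeasure (a := 1) (r := 1) one_pos one_pos
  have : IsProbabilityMeasure (volume.restrict (Set.Ioo (0 : ℝ) 1)) := ⟨by simp⟩
  unfold gammaUniformMeasure
  infer_instance

theorem ae_pos_gammaUniformMeasure (hA : 0 < A) (hℓ : 0 < ℓ) :
    ∀ᵐ p ∂(gammaUniformMeasure A ℓ), 0 < p.1 ∧ 0 < p.2.1.1 ∧ 0 < p.2.1.2 ∧ 0 < p.2.2 := by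
  have := isProbabilityMeasure_gammaMeasure (a := A) (r := 1) hA one_pos
  have := isProbabilityMeasure_gammaMeasure (a := ℓ) (r := 1) hℓ one_pos
  have := isProbabilityMeasure_gammaMeasure (a := 1) (r := 1) one_pos one_pos
  have hu : ∀ᵐ u ∂(volume.restrict (Set.Ioo (0 : ℝ) 1)), 0 < u :=
    (ae_restrict_mem measurableSet_Ioo).mono fun u hu => hu.1
  have h1 := Measure.quasiMeasurePreserving_fst
    (μ := gammaMeasure A 1) (ν := ((gammaMeasure ℓ 1).prod (gammaMeasure 1 1)).prod
    (volume.restrict (Set.Ioo (0 : ℝ) 1)))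
  have h2 := Measure.quasiMeasurePreserving_snd
    (μ := gammaMeasure A 1) (ν := ((gammaMeasure ℓ 1).prod (gammaMeasure 1 1)).prod
    (volume.restrict (Set.Ioo (0 : ℝ) 1)))
  have h3 := Measure.quasiMeasurePreserving_fst
    (μ := (gammaMeasure ℓ 1).prod (gammaMeasure 1 1)) (ν := volume.restrict (Set.Ioo (0 : ℝ) 1))
  have h4 := Measure.quasiMeasurePreserving_snd
    (μ := (gammaMeasure ℓ 1).prod (gammaMeasure 1 1)) (ν := volume.restrict (Set.Ioo (0 : ℝ) 1))
  have h5 := Measure.quasiMeasurePreserving_fst (μ := gammaMeasure ℓ 1) (ν := gammaMeasure 1 1)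
  have h6 := Measure.quasiMeasurePreserving_snd (μ := gammaMeasure ℓ 1) (ν := gammaMeasure 1 1)
  unfold gammaUniformMeasure
  filter_upwards [h1.ae (ae_pos_gammaMeasure A), h2.ae (h3.ae (h5.ae (ae_pos_gammaMeasure ℓ))),
    h2.ae (h3.ae (h6.ae (ae_pos_gammaMeasure 1))), h2.ae (h4.ae hu)] with p a b c d
  exact ⟨a, b, c, d⟩

theorem ae_mixedProduct_pos (hA : 0 < A) (hℓ : 0 < ℓ) :
    ∀ᵐ p ∂(gammaUniformMeasure A ℓ), 0 < mixedProduct κ p := by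
  filter_upwards [ae_pos_gammaUniformMeasure hA hℓ] with p hp
  obtain ⟨h1, h2, h3, h4⟩ := hp
  unfold mixedProduct
  positivity

theorem mixedProduct_cpow_neg_ae_eq (hA : 0 < A) (hℓ : 0 < ℓ) :
    (fun p => (mixedProduct κ p : ℂ) ^ (-s)) =ᵐ[gammaUniformMeasure A ℓ]
      fun p => (p.1 : ℂ) ^ (-s) * ((p.2.1.1 : ℂ) ^ (-s) * (p.2.1.2 : ℂ) ^ (-s) *
        ((p.2.2 ^ (-κ) : ℝ) : ℂ) ^ (-s)) := by
  filter_upwards [ae_pos_gammaUniformMeasure hA hℓ] with p hp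
  obtain ⟨h1, h2, h3, h4⟩ := hp
  rw [mixedProduct, Complex.ofReal_mul, Complex.mul_cpow_ofReal_nonneg (by positivity)
    (by positivity), Complex.ofReal_mul, Complex.mul_cpow_ofReal_nonneg (by positivity)
    (by positivity), Complex.ofReal_mul, Complex.mul_cpow_ofReal_nonneg (by positivity)
    (by positivity)]

/-- Independence factors the moment. The product formula for integrals holds without integrability,
so the value comes first and, being nonzero, then yields integrability in
`integrable_mixedProduct_cpow_neg`. -/
theorem integral_mixedProduct_cpow_neg (hA : 0 < A) (hℓ : 0 < ℓ) (hκ : 0 < κ) (hs : 0 < s.re)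
    (hsA : s.re < A) (hsℓ : s.re < ℓ) (hs1 : s.re < 1) :
    ∫ p, (mixedProduct κ p : ℂ) ^ (-s) ∂(gammaUniformMeasure A ℓ) =
      Complex.Gamma (A - s) / Complex.Gamma A *
        (Complex.Gamma (ℓ - s) / Complex.Gamma ℓ * Complex.Gamma (1 - s) * (1 / (1 + κ * s))) := by
  have := isProbabilityMeasure_gammaMeasure (a := A) (r := 1) hA one_pos
  have := isProbabilityMeasure_gammaMeasure (a := ℓ) (r := 1) hℓ one_pos
  have := isProbabilityMeasure_gammaMeasure (a := 1) (r := 1) one_pos one_pos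
  rw [integral_congr_ae (mixedProduct_cpow_neg_ae_eq hA hℓ), gammaUniformMeasure,
    integral_prod_mul (fun x : ℝ => (x : ℂ) ^ (-s))
      (fun p : (ℝ × ℝ) × ℝ => (p.1.1 : ℂ) ^ (-s) * (p.1.2 : ℂ) ^ (-s) *
        ((p.2 ^ (-κ) : ℝ) : ℂ) ^ (-s)),
    integral_prod_mul (fun p : ℝ × ℝ => (p.1 : ℂ) ^ (-s) * (p.2 : ℂ) ^ (-s))
      (fun u : ℝ => ((u ^ (-κ) : ℝ) : ℂ) ^ (-s)),
    integral_prod_mul (fun x : ℝ => (x : ℂ) ^ (-s)) (fun x : ℝ => (x : ℂ) ^ (-s)),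
    integral_cpow_neg_gammaMeasure hA hsA, integral_cpow_neg_gammaMeasure hℓ hsℓ,
    integral_cpow_neg_gammaMeasure one_pos hs1, integral_Ioo_cpow_rpow_neg hκ hs]
  simp

theorem one_add_ofReal_mul_ne_zero (hκ : 0 < κ) (hs : 0 < s.re) : 1 + κ * s ≠ 0 := fun h => by
  have := congrArg Complex.re h
  simp at this
  nlinarith [mul_pos hκ hs]

theorem integrable_mixedProduct_cpow_neg (hA : 0 < A) (hℓ : 0 < ℓ) (hκ : 0 < κ) (hs : 0 < s.re)
    (hsA : s.re < A) (hsℓ : s.re < ℓ) (hs1 : s.re < 1) :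
    Integrable (fun p => (mixedProduct κ p : ℂ) ^ (-s)) (gammaUniformMeasure A ℓ) := by
  refine Integrable.of_integral_ne_zero ?_
  rw [integral_mixedProduct_cpow_neg hA hℓ hκ hs hsA hsℓ hs1]
  have g1 : Complex.Gamma (A - s) ≠ 0 := Complex.Gamma_ne_zero_of_re_pos (by simpa using hsA)
  have g2 : Complex.Gamma (ℓ - s) ≠ 0 := Complex.Gamma_ne_zero_of_re_pos (by simpa using hsℓ)
  have g3 : Complex.Gamma (1 - s) ≠ 0 := Complex.Gamma_ne_zero_of_re_pos (by simpa using hs1)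
  have g4 : Complex.Gamma A ≠ 0 := Complex.Gamma_ne_zero_of_re_pos (by simpa using hA)
  have g5 : Complex.Gamma ℓ ≠ 0 := Complex.Gamma_ne_zero_of_re_pos (by simpa using hℓ)
  have g6 := one_add_ofReal_mul_ne_zero hκ hs
  simp [g1, g2, g3, g4, g5, g6]

theorem integrable_Gamma_mul_integral_mixedProduct (hA : 0 < A) (hℓ : 0 < ℓ) (hκ : 0 < κ) {c : ℝ}
    (hc : 0 < c) (hcA : c < A) (hcℓ : c < ℓ) (hc1 : c < 1) :
    Integrable fun t : ℝ => Complex.Gamma (c + t * Complex.I) *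
      ∫ p, (mixedProduct κ p : ℂ) ^ (-(c + t * Complex.I)) ∂(gammaUniformMeasure A ℓ) := by
  have hI := integrable_Gamma_mul_Gamma_one_sub_vertical hc hc1
  have c1 := continuous_Gamma_vertical (sub_pos.2 hcA) (-1)
  have c2 := continuous_Gamma_vertical (sub_pos.2 hcℓ) (-1)
  have hne : ∀ t : ℝ, (1 + κ * (c + t * Complex.I) : ℂ) ≠ 0 := fun t =>
    one_add_ofReal_mul_ne_zero hκ (by simpa using hc)
  have hcont : Continuous fun t : ℝ =>
      Complex.Gamma (A - (c + t * Complex.I)) / Complex.Gamma A *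
        (Complex.Gamma (ℓ - (c + t * Complex.I)) / Complex.Gamma ℓ *
          (1 / (1 + κ * (c + t * Complex.I)))) := by
    refine Continuous.mul ?_ (Continuous.mul ?_ ?_)
    · refine Continuous.div_const (c1.congr fun t => ?_) _
      push_cast
      ring_nf
    · refine Continuous.div_const (c2.congr fun t => ?_) _
      push_cast
      ring_nf
    · exact Continuous.div (by fun_prop) (by fun_prop) hne
  refine (hI.bdd_mul (c := Real.Gamma (A - c) / ‖Complex.Gamma A‖ *
    (Real.Gamma (ℓ - c) / ‖Complex.Gamma ℓ‖ * 1))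
    hcont.aestronglyMeasurable (Filter.Eventually.of_forall fun t => ?_)).congr
    (Filter.Eventually.of_forall fun t => ?_)
  · have e1 := norm_Gamma_le_Gamma_re (s := A - (c + t * Complex.I)) (by simpa using hcA)
    have e2 := norm_Gamma_le_Gamma_re (s := ℓ - (c + t * Complex.I)) (by simpa using hcℓ)
    simp at e1 e2
    have e3 : ‖1 / (1 + κ * (c + t * Complex.I) : ℂ)‖ ≤ 1 := by
      rw [norm_div, norm_one, div_le_one (norm_pos_iff.2 (hne t))]
      refine le_trans ?_ (Complex.re_le_norm _)
      simp
      positivity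
    rw [norm_mul, norm_mul, norm_div, norm_div]
    have := (norm_nonneg _).trans e2
    have := (norm_nonneg _).trans e1
    gcongr
  · simp only
    rw [integral_mixedProduct_cpow_neg hA hℓ hκ (by simpa using hc) (by simpa using hcA)
      (by simpa using hcℓ) (by simpa using hc1)]
    ring

end

/-! ### Meijer's function as a Laplace transform. -/

noncomputable section

theorem IsMeijerG.unique {p q m n : ℕ} {a : Fin p → ℂ} {b : Fin q → ℂ} {z w w' : ℂ}
    (h : IsMeijerG m n a b z w) (h' : IsMeijerG m n a b z w') : w = w' := by
  obtain ⟨-, -, -, ⟨c, hc⟩, h⟩ := h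
  obtain ⟨-, -, -, -, h'⟩ := h'
  rw [← (h c hc).2, ← (h' c hc).2]

theorem IsMeijerG.meijerG_eq {p q m n : ℕ} {a : Fin p → ℂ} {b : Fin q → ℂ} {z w : ℂ}
    (h : IsMeijerG m n a b z w) : meijerG m n a b z = w := by
  have hex : ∃ w, IsMeijerG m n a b z w := ⟨w, h⟩
  rw [meijerG, dif_pos hex]
  exact hex.choose_spec.unique h

/-- The poles from `ℓ - 1 ≥ 0` and those from `-2/δ - 1 < -1` impose nothing beyond the other
families. -/
theorem separatesPoles_iff {ℓ A δ : ℝ} (hℓ : 1 ≤ ℓ) (hδ : 0 < δ) (c : ℝ) :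
    SeparatesPoles 3 2 ![-2 / (δ : ℂ), 0] ![(ℓ : ℂ) - 1, 0, (A : ℂ) - 1, -1 - 2 / (δ : ℂ)] c ↔
      -1 < c ∧ c < 0 ∧ c < A - 1 := by
  have hd : (-2 / (δ : ℂ)).re = -(2 / δ) := by
    rw [show (-2 / (δ : ℂ)) = ((-(2 / δ) : ℝ) : ℂ) by push_cast; ring, Complex.ofReal_re]
  have hd' : 0 < 2 / δ := by positivity
  constructor
  · rintro ⟨h1, h2⟩
    have a1 := h1 1 (by decide) 0
    have a2 := h1 2 (by decide) 0
    have a3 := h2 1 (by decide) 0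
    simp at a1 a2 a3
    exact ⟨a3, a1, a2⟩
  · rintro ⟨h1, h2, h3⟩
    constructor
    · intro j hj k
      have hk : (0 : ℝ) ≤ k := k.cast_nonneg
      fin_cases j
      · simp; linarith
      · simp; linarith
      · simp; linarith
      · simp at hj
    · intro j hj k
      have hk : (0 : ℝ) ≤ k := k.cast_nonneg
      fin_cases j
      · simp [hd]; linarith
      · simp; linarith

/-- The functional equation gives `Γ(2/δ + s) / Γ(2/δ + s + 1) = (δ/2) / (1 + δs/2)`; the shift by
one accounts for the factor `z⁻¹`. -/
theorem meijerIntegrand_eq {ℓ A δ z : ℝ} (hδ : 0 < δ) (hz : 0 < z) {s : ℂ} (hs : 0 < s.re) :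
    meijerIntegrand 3 2 ![-2 / (δ : ℂ), 0] ![(ℓ : ℂ) - 1, 0, (A : ℂ) - 1, -1 - 2 / (δ : ℂ)] z
      (s - 1) =
      (z : ℂ)⁻¹ * (δ / 2) * ((z : ℂ) ^ s * (Complex.Gamma s * (Complex.Gamma (A - s) *
        (Complex.Gamma (ℓ - s) * Complex.Gamma (1 - s) * (1 / (1 + (δ / 2 : ℝ) * s)))))) := by
  have hδ' : (δ : ℂ) ≠ 0 := by exact_mod_cast hδ.ne'
  have hz' : (z : ℂ) ≠ 0 := by exact_mod_cast hz.ne'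
  have hd : (2 / (δ : ℂ)).re = 2 / δ := by
    rw [show (2 / (δ : ℂ)) = ((2 / δ : ℝ) : ℂ) by push_cast; ring, Complex.ofReal_re]
  have hre : 0 < (2 / (δ : ℂ) + s).re := by
    rw [Complex.add_re, hd]
    positivity
  have hne : 2 / (δ : ℂ) + s ≠ 0 := fun h => by simp [h] at hre
  have hG : Complex.Gamma (2 / (δ : ℂ) + s) ≠ 0 := Complex.Gamma_ne_zero_of_re_pos hre
  have hne' : (2 + δ * s : ℂ) ≠ 0 := by
    rw [show (2 + δ * s : ℂ) = δ * (2 / δ + s) by field_simp]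
    exact mul_ne_zero hδ' hne
  have hp4 : ∀ f : Fin 4 → ℂ, ∏ j : Fin 4 with j.val < 3, f j = f 0 * f 1 * f 2 := fun f => by
    rw [Finset.prod_filter, Fin.prod_univ_four]; simp
  have hq4 : ∀ f : Fin 4 → ℂ, ∏ j : Fin 4 with 3 ≤ j.val, f j = f 3 := fun f => by
    rw [Finset.prod_filter, Fin.prod_univ_four]; simp
  have hp2 : ∀ f : Fin 2 → ℂ, ∏ j : Fin 2 with j.val < 2, f j = f 0 * f 1 := fun f => by
    rw [Finset.prod_filter, Fin.prod_univ_two]; simp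
  have hq2 : ∀ f : Fin 2 → ℂ, ∏ j : Fin 2 with 2 ≤ j.val, f j = 1 := fun f => by
    rw [Finset.prod_filter, Fin.prod_univ_two]; simp
  rw [meijerIntegrand, hp4, hq4, hp2, hq2]
  simp only [Matrix.cons_val]
  rw [show (ℓ : ℂ) - 1 - (s - 1) = ℓ - s by ring, show (0 : ℂ) - (s - 1) = 1 - s by ring,
    show (A : ℂ) - 1 - (s - 1) = A - s by ring, show 1 - -2 / (δ : ℂ) + (s - 1) = 2 / δ + s by ring,
    show (1 : ℂ) - 0 + (s - 1) = s by ring,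
    show 1 - (-1 - 2 / (δ : ℂ)) + (s - 1) = 2 / δ + s + 1 by ring,
    Complex.Gamma_add_one _ hne, Complex.cpow_sub _ _ hz', Complex.cpow_one]
  rw [show (1 : ℂ) + (δ / 2 : ℝ) * s = (2 + δ * s) / 2 by push_cast; ring,
    show 2 / (δ : ℂ) + s = (2 + δ * s) / δ by field_simp] at *
  generalize Complex.Gamma ((2 + δ * s) / δ) = g at *
  generalize (2 + δ * s : ℂ) = w at *
  field_simp

/-- The value of the Meijer function as the Laplace transform of a positive random variable. -/
theorem isMeijerG_laplace {ℓ A δ z : ℝ} (hℓ : 1 ≤ ℓ) (hA : 0 < A) (hδ : 0 < δ) (hz : 0 < z) :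
    IsMeijerG 3 2 ![-2 / (δ : ℂ), 0] ![(ℓ : ℂ) - 1, 0, (A : ℂ) - 1, -1 - 2 / (δ : ℂ)] z
      ((z⁻¹ * (δ / 2) * (Real.Gamma A * Real.Gamma ℓ) *
        ∫ p, Real.exp (-(mixedProduct (δ / 2) p * z⁻¹)) ∂(gammaUniformMeasure A ℓ) : ℝ) : ℂ) := by
  have hℓ0 : 0 < ℓ := by linarith
  have hκ : 0 < δ / 2 := by positivity
  have gA : Complex.Gamma A ≠ 0 := Complex.Gamma_ne_zero_of_re_pos (by simpa using hA)
  have gℓ : Complex.Gamma ℓ ≠ 0 := Complex.Gamma_ne_zero_of_re_pos (by simpa using hℓ0)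
  have := isProbabilityMeasure_gammaUniformMeasure hA hℓ0
  refine ⟨by norm_num, le_rfl, by exact_mod_cast hz.ne', ?_, ?_⟩
  -- Midpoint of the strip `(-1, min 0 (A - 1))`, nonempty because `A > 0`.
  · refine ⟨min 0 (A - 1) / 2 - 1 / 2, (separatesPoles_iff hℓ hδ _).2 ?_⟩
    rcases le_total 0 (A - 1) with h | h
    · rw [min_eq_left h]
      refine ⟨?_, ?_, ?_⟩ <;> linarith
    · rw [min_eq_right h]
      refine ⟨?_, ?_, ?_⟩ <;> linarith
  · intro c hc
    obtain ⟨h1, h2, h3⟩ := (separatesPoles_iff hℓ hδ c).1 hc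
    have k0 : 0 < c + 1 := by linarith
    have kA : c + 1 < A := by linarith
    have k1 : c + 1 < 1 := by linarith
    have kℓ : c + 1 < ℓ := by linarith
    have hint : ∀ s : ℂ, s.re = c + 1 →
        Integrable (fun p => (mixedProduct (δ / 2) p : ℂ) ^ (-s)) (gammaUniformMeasure A ℓ) :=
      fun s hs => integrable_mixedProduct_cpow_neg hA hℓ0 hκ (by rwa [hs]) (by rwa [hs])
        (by rwa [hs]) (by rwa [hs])
    have hvert := integrable_Gamma_mul_integral_mixedProduct hA hℓ0 hκ k0 kA kℓ k1
    have hlap := laplace_eq_integral_vertical measurable_mixedProduct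
      (ae_mixedProduct_pos hA hℓ0) k0 hint hvert (inv_pos.2 hz)
    have heq : ∀ t : ℝ, meijerIntegrand 3 2 ![-2 / (δ : ℂ), 0]
        ![(ℓ : ℂ) - 1, 0, (A : ℂ) - 1, -1 - 2 / (δ : ℂ)] z (c + t * Complex.I) =
        ((z : ℂ)⁻¹ * (δ / 2) * (Complex.Gamma A * Complex.Gamma ℓ)) *
          (((z⁻¹ : ℝ) : ℂ) ^ (-((c + 1 : ℝ) + t * Complex.I)) *
            (Complex.Gamma ((c + 1 : ℝ) + t * Complex.I) *
              ∫ p, (mixedProduct (δ / 2) p : ℂ) ^ (-((c + 1 : ℝ) + t * Complex.I))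
                ∂(gammaUniformMeasure A ℓ))) := fun t => by
      have hre : (((c + 1 : ℝ) : ℂ) + t * Complex.I).re = c + 1 := by simp
      rw [integral_mixedProduct_cpow_neg hA hℓ0 hκ (by rwa [hre]) (by rwa [hre])
        (by rwa [hre]) (by rwa [hre]),
        show (c + t * Complex.I : ℂ) = ((c + 1 : ℝ) + t * Complex.I) - 1 by push_cast; ring,
        meijerIntegrand_eq hδ hz (by rwa [hre]), Complex.ofReal_inv, Complex.inv_cpow,
        Complex.cpow_neg, inv_inv]
      · field_simp
      · rw [Complex.arg_ofReal_of_nonneg hz.le]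
        exact Real.pi_pos.ne
    simp only [heq]
    refine ⟨?_, ?_⟩
    · refine Integrable.const_mul (hvert.bdd_mul (c := z⁻¹ ^ (-(c + 1))) ?_ ?_) _
      · exact Measurable.aestronglyMeasurable (by fun_prop)
      · refine Filter.Eventually.of_forall fun t => le_of_eq ?_
        rw [norm_cpow_neg_of_pos (inv_pos.2 hz)]
        simp
    · rw [integral_const_mul, mul_left_comm, hlap]
      push_cast
      rw [← Complex.Gamma_ofReal, ← Complex.Gamma_ofReal, ← integral_complex_ofReal]
      push_cast
      rfl

end

/-! ### The law of the reflected sum. -/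

noncomputable section

/-- The uniform distribution of a phase. -/
abbrev phaseMeasure : Measure ℝ := cond volume (Set.Ioo (-Real.pi) Real.pi)

instance isProbabilityMeasure_phaseMeasure : IsProbabilityMeasure phaseMeasure := by
  refine cond_isProbabilityMeasure_of_finite ?_ ?_ <;> simp [Real.pi_pos]

theorem integral_phaseMeasure (f : ℝ → ℂ) :
    ∫ θ, f θ ∂phaseMeasure =
      (2 * Real.pi : ℂ)⁻¹ * ∫ θ in Set.Ioo (-Real.pi) Real.pi, f θ := by
  have h2 : (0 : ℝ) ≤ Real.pi + Real.pi := by positivity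
  rw [phaseMeasure, ProbabilityTheory.cond, integral_smul_measure, Real.volume_Ioo, sub_neg_eq_add,
    ENNReal.toReal_inv, ENNReal.toReal_ofReal h2, Complex.real_smul]
  push_cast
  ring

theorem integrableOn_Ioi_mul_exp_neg_sq :
    IntegrableOn (fun r : ℝ => r * Real.exp (-r ^ 2 / 2)) (Set.Ioi 0) := by
  refine Integrable.of_integral_ne_zero ?_
  have h := integral_rayleighMeasure_one (fun _ => (1 : ℝ))
  simp only [integral_const, probReal_univ, smul_eq_mul, mul_one] at h
  rw [← h]
  exact one_ne_zero

/-- Polar coordinates: Rayleigh modulus and uniform phase make a standard complex Gaussian. -/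
theorem integral_rayleighMeasure_prod_phaseMeasure {f : ℂ → ℂ} (hf : Continuous f)
    (hf1 : ∀ z, ‖f z‖ ≤ 1) :
    ∫ p, f (p.1 * Complex.exp (Complex.I * p.2)) ∂((rayleighMeasure 1).prod phaseMeasure) =
      (2 * Real.pi : ℂ)⁻¹ * ∫ z : ℂ, Complex.exp (-‖z‖ ^ 2 / 2) * f z := by
  have hc : Continuous fun p : ℝ × ℝ => f (p.1 * Complex.exp (Complex.I * p.2)) := by fun_prop
  rw [integral_prod _ ((integrable_const (1 : ℝ)).mono' hc.aestronglyMeasurable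
    (Filter.Eventually.of_forall fun p => hf1 _))]
  simp only [integral_phaseMeasure]
  rw [integral_const_mul, integral_rayleighMeasure_one,
    ← Complex.integral_comp_polarCoord_symm (fun z => Complex.exp (-‖z‖ ^ 2 / 2) * f z),
    polarCoord_target]
  congr 1
  have hI : Integrable (fun p : ℝ × ℝ => ((p.1 * Real.exp (-p.1 ^ 2 / 2) : ℝ) : ℂ) *
      f (p.1 * Complex.exp (Complex.I * p.2)))
      ((volume.restrict (Set.Ioi 0)).prod (volume.restrict (Set.Ioo (-Real.pi) Real.pi))) := by
    have h1 := (integrableOn_Ioi_mul_exp_neg_sq.ofReal (𝕜 := ℂ)).mul_prod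
      (integrable_const (μ := volume.restrict (Set.Ioo (-Real.pi) Real.pi)) (1 : ℂ))
    simp only [mul_one] at h1
    exact h1.mul_bdd (c := 1) hc.aestronglyMeasurable
      (Filter.Eventually.of_forall fun p => hf1 _)
  rw [Measure.volume_eq_prod, ← Measure.prod_restrict]
  calc _ = ∫ p : ℝ × ℝ, ((p.1 * Real.exp (-p.1 ^ 2 / 2) : ℝ) : ℂ) *
      f (p.1 * Complex.exp (Complex.I * p.2))
      ∂((volume.restrict (Set.Ioi 0)).prod (volume.restrict (Set.Ioo (-Real.pi) Real.pi))) := by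
        rw [integral_prod _ hI]
        simp only [Complex.real_smul, integral_const_mul]
    _ = _ := by
        refine integral_congr_ae (Filter.Eventually.of_forall fun p => ?_)
        have : (Complex.cos p.2 + Complex.sin p.2 * Complex.I) =
            Complex.exp (Complex.I * p.2) := by
          rw [mul_comm Complex.I, Complex.exp_mul_I]
        have habs : ((|p.1| : ℝ) : ℂ) ^ 2 = (p.1 : ℂ) ^ 2 := by
          rw [← Complex.ofReal_pow, sq_abs, Complex.ofReal_pow]
        simp only [Complex.polarCoord_symm_apply, Complex.real_smul, Complex.ofReal_cos,
          Complex.ofReal_sin, this, norm_mul, Complex.norm_real, Complex.norm_exp]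
        simp [mul_assoc, habs]

theorem integral_exp_inner_rayleighMeasure_prod_phaseMeasure (t : ℂ) :
    ∫ p, Complex.exp ((inner ℝ ((p.1 : ℂ) * Complex.exp (Complex.I * (p.2 : ℂ))) t : ℝ) *
      Complex.I) ∂((rayleighMeasure 1).prod phaseMeasure) = Complex.exp (-‖t‖ ^ 2 / 2) := by
  rw [integral_rayleighMeasure_prod_phaseMeasure
    (f := fun z => Complex.exp ((inner ℝ z t : ℝ) * Complex.I)) (by fun_prop)
    (fun z => by rw [Complex.norm_exp_ofReal_mul_I])]
  have h := GaussianFourier.integral_cexp_neg_mul_sq_norm_add (V := ℂ) (b := 1 / 2)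
    (by norm_num) Complex.I t
  simp only [← Complex.exp_add]
  have h' : (fun z : ℂ => Complex.exp (-‖z‖ ^ 2 / 2 + (inner ℝ z t : ℝ) * Complex.I)) =
      fun z : ℂ => Complex.exp (-(1 / 2) * ‖z‖ ^ 2 + Complex.I * (inner ℝ t z : ℝ)) := by
    ext z
    rw [real_inner_comm]
    ring_nf
  rw [h', h]
  have hpi : (Real.pi : ℂ) ≠ 0 := by exact_mod_cast Real.pi_ne_zero
  simp [Complex.finrank_real_complex]
  field_simp
  ring_nf

/-- Conditionally on the scale the variable is Gaussian. Taking `φ` Rayleigh gives one reflected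
path; taking `φ = √(2X)` gives the candidate for the whole sum. -/
theorem charFun_map_mul_polar (η : Measure ℝ) [IsProbabilityMeasure η] {φ : ℝ → ℝ}
    (hφ : Measurable φ) (t : ℂ) :
    charFun ((η.prod ((rayleighMeasure 1).prod phaseMeasure)).map
      fun p => (φ p.1 : ℂ) * ((p.2.1 : ℂ) * Complex.exp (Complex.I * p.2.2))) t =
      ((∫ x, Real.exp (-(φ x ^ 2 / 2 * ‖t‖ ^ 2)) ∂η : ℝ) : ℂ) := by
  have hm : Measurable fun p : ℝ × ℝ × ℝ =>
      (φ p.1 : ℂ) * ((p.2.1 : ℂ) * Complex.exp (Complex.I * p.2.2)) := by fun_prop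
  rw [charFun_apply, integral_map hm.aemeasurable
    (Continuous.aestronglyMeasurable (by fun_prop)), integral_prod]
  · rw [← integral_complex_ofReal]
    refine integral_congr_ae (Filter.Eventually.of_forall fun x => ?_)
    have h := integral_exp_inner_rayleighMeasure_prod_phaseMeasure ((φ x : ℝ) • t)
    simp only [inner_smul_right, norm_smul] at h
    simp only [← Complex.real_smul (x := φ x), inner_smul_left, conj_trivial]
    rw [h]
    push_cast
    rw [mul_pow, ← Complex.ofReal_pow, Real.norm_eq_abs, sq_abs]
    push_cast
    ring_nf
  · refine (integrable_const (1 : ℝ)).mono' (Measurable.aestronglyMeasurable (by fun_prop)) ?_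
    exact Filter.Eventually.of_forall fun p => by rw [Complex.norm_exp_ofReal_mul_I]

theorem charFun_map_rayleigh_mul_polar (t : ℂ) :
    charFun (((rayleighMeasure 1).prod ((rayleighMeasure 1).prod phaseMeasure)).map
      fun p => (p.1 : ℂ) * ((p.2.1 : ℂ) * Complex.exp (Complex.I * p.2.2))) t =
      (((1 + ‖t‖ ^ 2)⁻¹ : ℝ) : ℂ) := by
  rw [charFun_map_mul_polar (rayleighMeasure 1) (φ := fun x => x) measurable_id t,
    integral_sq_div_two_rayleighMeasure_one (fun x => Real.exp (-(x * ‖t‖ ^ 2))),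
    integral_exp_neg_mul_gammaMeasure one_pos (by positivity), Real.rpow_neg_one]

theorem charFun_map_sqrt_gamma_mul_polar {ℓ : ℝ} (hℓ : 0 < ℓ) (t : ℂ) :
    charFun (((gammaMeasure ℓ 1).prod ((rayleighMeasure 1).prod phaseMeasure)).map
      fun p => ((Real.sqrt (2 * p.1) : ℝ) : ℂ) *
        ((p.2.1 : ℂ) * Complex.exp (Complex.I * p.2.2))) t =
      (((1 + ‖t‖ ^ 2) ^ (-ℓ) : ℝ) : ℂ) := by
  have := isProbabilityMeasure_gammaMeasure (a := ℓ) (r := 1) hℓ one_pos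
  rw [charFun_map_mul_polar (gammaMeasure ℓ 1) (φ := fun x => Real.sqrt (2 * x)) (by fun_prop) t,
    ← integral_exp_neg_mul_gammaMeasure hℓ (by positivity)]
  congr 1
  refine integral_congr_ae ?_
  filter_upwards [ae_pos_gammaMeasure ℓ] with x hx
  rw [Real.sq_sqrt (by positivity)]
  ring_nf

/-- The superposition of the reflected signals, as a function of all fading amplitudes and phase
errors. -/
def reflectedSum {L : ℕ} (q : Fin L ⊕ Fin L ⊕ Fin L → ℝ) : ℂ :=
  ∑ l, ((q (.inl l) : ℂ) * (q (.inr (.inl l)) : ℂ) *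
    Complex.exp (Complex.I * (q (.inr (.inr l)) : ℂ)))

theorem measurable_reflectedSum {L : ℕ} : Measurable (reflectedSum (L := L)) := by
  unfold reflectedSum
  fun_prop

/-- The marginal laws of the fading amplitudes and phase errors. -/
def fadingLaw (L : ℕ) : Fin L ⊕ Fin L ⊕ Fin L → Measure ℝ :=
  Sum.elim (fun _ => rayleighMeasure 1) (Sum.elim (fun _ => rayleighMeasure 1)
    (fun _ => phaseMeasure))

instance (L : ℕ) (i : Fin L ⊕ Fin L ⊕ Fin L) : IsProbabilityMeasure (fadingLaw L i) := by
  rcases i with i | i | i <;> simp only [fadingLaw, Sum.elim_inl, Sum.elim_inr] <;> infer_instance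

/-- Regroups a family of triples into a family indexed by a sum type. -/
def regroup {L : ℕ} (q : Fin L → ℝ × ℝ × ℝ) : Fin L ⊕ Fin L ⊕ Fin L → ℝ :=
  Sum.elim (fun l => (q l).1) (Sum.elim (fun l => (q l).2.1) (fun l => (q l).2.2))

theorem measurePreserving_regroup (L : ℕ) :
    MeasurePreserving (regroup (L := L))
      (Measure.pi fun _ => (rayleighMeasure 1).prod ((rayleighMeasure 1).prod phaseMeasure))
      (Measure.pi (fadingLaw L)) := by
  have e1 := measurePreserving_arrowProdEquivProdArrow ℝ (ℝ × ℝ) (Fin L)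
    (fun _ => rayleighMeasure 1) (fun _ => (rayleighMeasure 1).prod phaseMeasure)
  have e2 := measurePreserving_arrowProdEquivProdArrow ℝ ℝ (Fin L)
    (fun _ => rayleighMeasure 1) (fun _ => phaseMeasure)
  have e3 := measurePreserving_sumPiEquivProdPi_symm (fun i => fadingLaw L (.inr i))
  have e4 := measurePreserving_sumPiEquivProdPi_symm (fadingLaw L)
  have e5 := (MeasurePreserving.id (Measure.pi fun _ : Fin L => rayleighMeasure 1)).prod
    (e3.comp e2)
  have e6 := e4.comp (e5.comp e1)
  convert e6 using 1
  ext q i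
  rcases i with i | i | i <;> rfl

/-- Both laws have characteristic function `(1 + |t|²)^(-L)`: on the left as an `L`-fold product
over independent paths, on the right from the Laplace transform of `Γ(L)`. -/
theorem map_reflectedSum_pi {L : ℕ} (hL : 1 ≤ L) :
    (Measure.pi (fadingLaw L)).map reflectedSum =
      ((gammaMeasure L 1).prod ((rayleighMeasure 1).prod phaseMeasure)).map
      fun p => ((Real.sqrt (2 * p.1) : ℝ) : ℂ) *
        ((p.2.1 : ℂ) * Complex.exp (Complex.I * p.2.2)) := by
  have hL0 : (0 : ℝ) < L := by exact_mod_cast hL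
  have := isProbabilityMeasure_gammaMeasure (a := L) (r := 1) hL0 one_pos
  have hm : Measurable fun p : ℝ × ℝ × ℝ =>
      (p.1 : ℂ) * ((p.2.1 : ℂ) * Complex.exp (Complex.I * p.2.2)) := by fun_prop
  have := Measure.isProbabilityMeasure_map
    (μ := (rayleighMeasure 1).prod ((rayleighMeasure 1).prod phaseMeasure)) hm.aemeasurable
  rw [← (measurePreserving_regroup L).map_eq,
    Measure.map_map measurable_reflectedSum (measurePreserving_regroup L).measurable]
  have h1 : (reflectedSum ∘ regroup (L := L)) =
      (fun p : Fin L → ℂ => ∑ l, p l) ∘ fun q l =>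
        ((q l).1 : ℂ) * (((q l).2.1 : ℂ) * Complex.exp (Complex.I * (q l).2.2)) := by
    ext q
    simp [reflectedSum, regroup, mul_assoc]
  rw [h1, ← Measure.map_map (by fun_prop) (by fun_prop),
    Measure.pi_map_pi (μ := fun _ : Fin L =>
      (rayleighMeasure 1).prod ((rayleighMeasure 1).prod phaseMeasure)) (fun _ => hm.aemeasurable)]
  refine Measure.ext_of_charFun (funext fun t => ?_)
  rw [charFun_map_sum_pi_eq_prod, Finset.prod_apply, charFun_map_sqrt_gamma_mul_polar hL0]
  simp only [charFun_map_rayleigh_mul_polar]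
  rw [Finset.prod_const, Finset.card_univ, Fintype.card_fin, Real.rpow_neg (by positivity),
    Real.rpow_natCast]
  push_cast
  rw [inv_pow]

/-- The law of the squared modulus of the superposition. -/
def powerGainLaw (ℓ : ℝ) : Measure ℝ :=
  ((gammaMeasure ℓ 1).prod (gammaMeasure 1 1)).map fun p => 4 * (p.1 * p.2)

theorem map_norm_sq_reflectedSum_pi {L : ℕ} (hL : 1 ≤ L) :
    (Measure.pi (fadingLaw L)).map (fun q => ‖reflectedSum q‖ ^ 2) = powerGainLaw L := by
  have hL0 : (0 : ℝ) < L := by exact_mod_cast hL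
  have := isProbabilityMeasure_gammaMeasure (a := L) (r := 1) hL0 one_pos
  have := isProbabilityMeasure_gammaMeasure (a := 1) (r := 1) one_pos one_pos
  have h1 : (fun q : Fin L ⊕ Fin L ⊕ Fin L → ℝ => ‖reflectedSum q‖ ^ 2) =
      (fun z : ℂ => ‖z‖ ^ 2) ∘ reflectedSum := rfl
  rw [h1, ← Measure.map_map (by fun_prop) measurable_reflectedSum, map_reflectedSum_pi hL,
    Measure.map_map (by fun_prop) (by fun_prop)]
  have e1 : MeasurePreserving (fun x : ℝ => x ^ 2 / 2) (rayleighMeasure 1) (gammaMeasure 1 1) :=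
    ⟨by fun_prop, map_sq_div_two_rayleighMeasure_one⟩
  have e2 := (MeasurePreserving.id (gammaMeasure L 1)).prod
    (e1.comp (measurePreserving_fst (μ := rayleighMeasure 1) (ν := phaseMeasure)))
  rw [powerGainLaw, ← e2.map_eq, Measure.map_map (by fun_prop) e2.measurable]
  refine Measure.map_congr ?_
  have h2 := Measure.quasiMeasurePreserving_fst
    (μ := gammaMeasure L 1) (ν := (rayleighMeasure 1).prod phaseMeasure)
  filter_upwards [h2.ae (ae_pos_gammaMeasure L)] with p hp
  have : ‖Complex.exp (Complex.I * p.2.2)‖ = 1 := by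
    rw [mul_comm, Complex.norm_exp_ofReal_mul_I]
  simp only [Function.comp_apply, Prod.map, id, norm_mul, Complex.norm_real, this, mul_one,
    mul_pow, Real.norm_eq_abs, sq_abs]
  rw [Real.sq_sqrt (by positivity)]
  ring

end

/-! ### The uniform position in the ring. -/

noncomputable section

theorem measurableSet_planarRing (O : EuclideanSpace ℝ (Fin 2)) (R₁ R₂ : ℝ) :
    MeasurableSet (planarRing O R₁ R₂) := by
  have h : Measurable fun x => dist O x := by fun_prop
  exact (measurableSet_le measurable_const h).inter (measurableSet_le h measurable_const)

theorem integral_Ioi_id_smul_eq_integral_sqrt (F : ℝ → ℝ) :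
    ∫ r in Set.Ioi (0 : ℝ), r * F r = (1 / 2) * ∫ v in Set.Ioi (0 : ℝ), F (Real.sqrt v) := by
  rw [← integral_comp_rpow_Ioi_of_pos (p := 2) (g := fun v => F (Real.sqrt v)) two_pos,
    ← integral_const_mul]
  refine setIntegral_congr_fun measurableSet_Ioi fun r hr => ?_
  have : Real.sqrt (r ^ (2 : ℝ)) = r := by
    rw [Real.rpow_two, Real.sqrt_sq (le_of_lt hr)]
  simp only [this, smul_eq_mul]
  norm_num
  ring

/-- Polar coordinates followed by `v = r²`. The area of the unit disc stays unevaluated, as it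
cancels on normalising. -/
theorem setIntegral_planarRing_dist (O : EuclideanSpace ℝ (Fin 2)) {R₁ R₂ : ℝ} (hR₁ : 0 < R₁)
    (hR : R₁ < R₂) (f : ℝ → ℝ) :
    ∫ x in planarRing O R₁ R₂, f (dist O x) =
      volume.real (Metric.ball (0 : EuclideanSpace ℝ (Fin 2)) 1) *
        ∫ v in (R₁ ^ 2)..(R₂ ^ 2), f (Real.sqrt v) := by
  have hsq : R₁ ^ 2 ≤ R₂ ^ 2 := by gcongr
  set F : ℝ → ℝ := (Set.Icc R₁ R₂).indicator f with hF
  have h1 : (planarRing O R₁ R₂).indicator (fun x => f (dist O x)) = fun x => F ‖x - O‖ := by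
    ext x
    rw [← dist_eq_norm, dist_comm x O, hF]
    by_cases hx : dist O x ∈ Set.Icc R₁ R₂
    · rw [Set.indicator_of_mem hx, Set.indicator_of_mem (show x ∈ planarRing O R₁ R₂ from hx)]
    · rw [Set.indicator_of_notMem hx, Set.indicator_of_notMem (show x ∉ planarRing O R₁ R₂ from hx)]
  rw [← integral_indicator (measurableSet_planarRing O R₁ R₂), h1,
    integral_sub_right_eq_self (fun x => F ‖x‖) O, integral_fun_norm_addHaar]
  simp only [finrank_euclideanSpace, Fintype.card_fin, smul_eq_mul, nsmul_eq_mul, Nat.add_one_sub_one,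
    pow_one]
  rw [integral_Ioi_id_smul_eq_integral_sqrt, intervalIntegral.integral_of_le hsq,
    ← integral_Icc_eq_integral_Ioc, ← integral_indicator measurableSet_Icc,
    ← integral_indicator measurableSet_Ioi]
  have h2 : (Set.Ioi (0 : ℝ)).indicator (fun v => F (Real.sqrt v)) =
      (Set.Icc (R₁ ^ 2) (R₂ ^ 2)).indicator fun v => f (Real.sqrt v) := by
    ext v
    by_cases hv : v ∈ Set.Icc (R₁ ^ 2) (R₂ ^ 2)
    · have hv0 : 0 < v := lt_of_lt_of_le (by positivity) hv.1
      rw [Set.indicator_of_mem hv, Set.indicator_of_mem (Set.mem_Ioi.2 hv0), hF,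
        Set.indicator_of_mem]
      exact ⟨Real.le_sqrt_of_sq_le hv.1, (Real.sqrt_le_left (by linarith)).2 hv.2⟩
    · rw [Set.indicator_of_notMem hv]
      by_cases hv0 : 0 < v
      · rw [Set.indicator_of_mem (Set.mem_Ioi.2 hv0), hF, Set.indicator_of_notMem]
        rintro ⟨a1, a2⟩
        exact hv ⟨(Real.le_sqrt hR₁.le hv0.le).1 a1, (Real.sqrt_le_left (by linarith)).1 a2⟩
      · rw [Set.indicator_of_notMem (by simpa using hv0)]
  rw [h2]
  push_cast
  ring

theorem volume_real_planarRing (O : EuclideanSpace ℝ (Fin 2)) {R₁ R₂ : ℝ} (hR₁ : 0 < R₁)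
    (hR : R₁ < R₂) :
    volume.real (planarRing O R₁ R₂) =
      volume.real (Metric.ball (0 : EuclideanSpace ℝ (Fin 2)) 1) * (R₂ ^ 2 - R₁ ^ 2) := by
  simpa using setIntegral_planarRing_dist O hR₁ hR (fun _ => 1)

theorem volume_real_ball_pos :
    0 < volume.real (Metric.ball (0 : EuclideanSpace ℝ (Fin 2)) 1) :=
  ENNReal.toReal_pos (Metric.measure_ball_pos _ _ one_pos).ne' measure_ball_lt_top.ne

theorem sq_sub_sq_pos_of_lt {R₁ R₂ : ℝ} (hR₁ : 0 < R₁) (hR : R₁ < R₂) : 0 < R₂ ^ 2 - R₁ ^ 2 := by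
  nlinarith

theorem isProbabilityMeasure_cond_planarRing (O : EuclideanSpace ℝ (Fin 2)) {R₁ R₂ : ℝ}
    (hR₁ : 0 < R₁) (hR : R₁ < R₂) :
    IsProbabilityMeasure (ProbabilityTheory.cond volume (planarRing O R₁ R₂)) := by
  have h : 0 < volume.real (planarRing O R₁ R₂) := by
    rw [volume_real_planarRing O hR₁ hR]
    exact mul_pos volume_real_ball_pos (sq_sub_sq_pos_of_lt hR₁ hR)
  have h' := ENNReal.toReal_pos_iff.1 h
  exact cond_isProbabilityMeasure_of_finite h'.1.ne' h'.2.ne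

theorem integral_cond_planarRing_dist (O : EuclideanSpace ℝ (Fin 2)) {R₁ R₂ : ℝ} (hR₁ : 0 < R₁)
    (hR : R₁ < R₂) (f : ℝ → ℝ) :
    ∫ x, f (dist O x) ∂(ProbabilityTheory.cond volume (planarRing O R₁ R₂)) =
      (R₂ ^ 2 - R₁ ^ 2)⁻¹ * ∫ v in (R₁ ^ 2)..(R₂ ^ 2), f (Real.sqrt v) := by
  rw [ProbabilityTheory.cond, integral_smul_measure, setIntegral_planarRing_dist O hR₁ hR,
    ENNReal.toReal_inv, ← measureReal_def, volume_real_planarRing O hR₁ hR, smul_eq_mul, mul_inv]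
  have := volume_real_ball_pos.ne'
  field_simp

theorem isProbabilityMeasure_powerGainLaw {ℓ : ℝ} (hℓ : 0 < ℓ) :
    IsProbabilityMeasure (powerGainLaw ℓ) := by
  have := isProbabilityMeasure_gammaMeasure (a := ℓ) (r := 1) hℓ one_pos
  have := isProbabilityMeasure_gammaMeasure (a := 1) (r := 1) one_pos one_pos
  exact Measure.isProbabilityMeasure_map (by fun_prop)

theorem ae_pos_gammaMeasure_prod {ℓ : ℝ} (hℓ : 0 < ℓ) :
    ∀ᵐ p ∂((gammaMeasure ℓ 1).prod (gammaMeasure 1 1)), 0 < p.1 ∧ 0 < p.2 := by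
  have := isProbabilityMeasure_gammaMeasure (a := ℓ) (r := 1) hℓ one_pos
  have := isProbabilityMeasure_gammaMeasure (a := 1) (r := 1) one_pos one_pos
  have h5 := Measure.quasiMeasurePreserving_fst (μ := gammaMeasure ℓ 1) (ν := gammaMeasure 1 1)
  have h6 := Measure.quasiMeasurePreserving_snd (μ := gammaMeasure ℓ 1) (ν := gammaMeasure 1 1)
  filter_upwards [h5.ae (ae_pos_gammaMeasure ℓ), h6.ae (ae_pos_gammaMeasure 1)] with p a b
  exact ⟨a, b⟩

theorem ae_pos_powerGainLaw {ℓ : ℝ} (hℓ : 0 < ℓ) : ∀ᵐ z ∂(powerGainLaw ℓ), 0 < z := by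
  rw [powerGainLaw, ae_map_iff (by fun_prop) measurableSet_Ioi]
  filter_upwards [ae_pos_gammaMeasure_prod hℓ] with p hp
  obtain ⟨a, b⟩ := hp
  positivity

/-! ### Averaging over gain and distance. -/

section Attenuated

variable {A ℓ γ δ : ℝ}

theorem norm_one_add_div_rpow_neg_le_one (hA : 0 < A) (hγ : 0 < γ) {z r : ℝ} (hz : 0 ≤ z) (hr : 0 ≤ r) :
    ‖(1 + γ * z / r ^ δ) ^ (-A)‖ ≤ 1 := by
  have h : 0 ≤ γ * z / r ^ δ := by positivity
  rw [Real.norm_of_nonneg (by positivity)]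
  exact Real.rpow_le_one_of_one_le_of_nonpos (by linarith) (by linarith)

/-- The expectation of `(1 + γ Z / r ^ δ) ^ (-A)` for a gain `Z` with law `powerGainLaw ℓ`. -/
def attenuatedMean (A ℓ γ δ r : ℝ) : ℝ :=
  ∫ z, (1 + γ * z / r ^ δ) ^ (-A) ∂(powerGainLaw ℓ)

theorem measurable_attenuatedMean (hℓ : 0 < ℓ) : Measurable (attenuatedMean A ℓ γ δ) := by
  have := isProbabilityMeasure_powerGainLaw hℓ
  have hm : Measurable fun p : ℝ × ℝ => (1 + γ * p.2 / p.1 ^ δ) ^ (-A) := by fun_prop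
  exact hm.stronglyMeasurable.integral_prod_right.measurable

theorem norm_attenuatedMean_le_one (hA : 0 < A) (hℓ : 0 < ℓ) (hγ : 0 < γ) {r : ℝ} (hr : 0 ≤ r) :
    ‖attenuatedMean A ℓ γ δ r‖ ≤ 1 := by
  have := isProbabilityMeasure_powerGainLaw hℓ
  refine (norm_integral_le_of_norm_le_const (C := 1) ?_).trans (by simp)
  filter_upwards [ae_pos_powerGainLaw hℓ] with z hz
  exact norm_one_add_div_rpow_neg_le_one hA hγ hz.le hr

/-- The bound by `1` persists for `v ≤ 0`, where `√v = 0`, so the endpoints are arbitrary. -/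
theorem intervalIntegrable_attenuatedMean_sqrt (hA : 0 < A) (hℓ : 0 < ℓ) (hγ : 0 < γ) (a b : ℝ) :
    IntervalIntegrable (fun v => attenuatedMean A ℓ γ δ (Real.sqrt v)) volume a b := by
  refine (intervalIntegrable_const (c := (1 : ℝ))).mono_fun
    ((measurable_attenuatedMean hℓ).comp (by fun_prop)).aestronglyMeasurable ?_
  refine Filter.Eventually.of_forall fun v => ?_
  simpa using norm_attenuatedMean_le_one (δ := δ) hA hℓ hγ (Real.sqrt_nonneg v)

/-- Links the Laplace transform to a full disc of radius `R`: the `Γ(A)` variable integrates to the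
power `-A`, and `v = R² u` turns the uniform variable into the squared distance. -/
theorem integral_exp_neg_mixedProduct (hA : 0 < A) (hℓ : 0 < ℓ) (hγ : 0 < γ) {R : ℝ}
    (hR : 0 < R) :
    R ^ 2 * ∫ p, Real.exp (-(mixedProduct (δ / 2) p * (R ^ δ / (4 * γ))⁻¹))
      ∂(gammaUniformMeasure A ℓ) =
      ∫ v in (0 : ℝ)..(R ^ 2), attenuatedMean A ℓ γ δ (Real.sqrt v) := by
  have i0 := isProbabilityMeasure_gammaUniformMeasure hA hℓ
  have i1 := isProbabilityMeasure_gammaMeasure (a := A) (r := 1) hA one_pos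
  have i2 := isProbabilityMeasure_gammaMeasure (a := ℓ) (r := 1) hℓ one_pos
  have i3 := isProbabilityMeasure_gammaMeasure (a := 1) (r := 1) one_pos one_pos
  have i4 : IsProbabilityMeasure (volume.restrict (Set.Ioo (0 : ℝ) 1)) := ⟨by simp⟩
  have hI : Integrable (fun p => Real.exp (-(mixedProduct (δ / 2) p * (R ^ δ / (4 * γ))⁻¹)))
      (gammaUniformMeasure A ℓ) := by
    refine (integrable_const (1 : ℝ)).mono' ?_ ?_
    · have := measurable_mixedProduct (κ := δ / 2)
      exact Measurable.aestronglyMeasurable (by fun_prop)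
    · filter_upwards [ae_mixedProduct_pos (κ := δ / 2) hA hℓ] with p hp
      rw [Real.norm_of_nonneg (Real.exp_nonneg _), Real.exp_le_one_iff, neg_nonpos]
      positivity
  have hm : Measurable fun p : (ℝ × ℝ) × ℝ =>
      (1 + p.1.1 * p.1.2 * p.2 ^ (-(δ / 2)) * (R ^ δ / (4 * γ))⁻¹) ^ (-A) := by fun_prop
  have hpos : ∀ᵐ p ∂(((gammaMeasure ℓ 1).prod (gammaMeasure 1 1)).prod
      (volume.restrict (Set.Ioo (0 : ℝ) 1))), 0 < p.1.1 ∧ 0 < p.1.2 ∧ 0 < p.2 := by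
    have h3 := Measure.quasiMeasurePreserving_fst
      (μ := (gammaMeasure ℓ 1).prod (gammaMeasure 1 1)) (ν := volume.restrict (Set.Ioo (0 : ℝ) 1))
    have h4 := Measure.quasiMeasurePreserving_snd
      (μ := (gammaMeasure ℓ 1).prod (gammaMeasure 1 1)) (ν := volume.restrict (Set.Ioo (0 : ℝ) 1))
    have hu : ∀ᵐ u ∂(volume.restrict (Set.Ioo (0 : ℝ) 1)), 0 < u :=
      (ae_restrict_mem measurableSet_Ioo).mono fun u hu => hu.1
    filter_upwards [h3.ae (ae_pos_gammaMeasure_prod hℓ), h4.ae hu] with p a b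
    exact ⟨a.1, a.2, b⟩
  have h1 : ∫ p, Real.exp (-(mixedProduct (δ / 2) p * (R ^ δ / (4 * γ))⁻¹))
      ∂(gammaUniformMeasure A ℓ) =
      ∫ p : (ℝ × ℝ) × ℝ, (1 + p.1.1 * p.1.2 * p.2 ^ (-(δ / 2)) * (R ^ δ / (4 * γ))⁻¹) ^ (-A)
        ∂(((gammaMeasure ℓ 1).prod (gammaMeasure 1 1)).prod
          (volume.restrict (Set.Ioo (0 : ℝ) 1))) := by
    rw [gammaUniformMeasure] at hI ⊢
    rw [integral_prod_symm _ hI]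
    refine integral_congr_ae ?_
    filter_upwards [hpos] with p hp
    obtain ⟨a, b, c⟩ := hp
    simp only [mixedProduct, mul_assoc]
    rw [integral_exp_neg_mul_gammaMeasure hA (by positivity)]
  have hI2 : Integrable (fun p : (ℝ × ℝ) × ℝ =>
      (1 + p.1.1 * p.1.2 * p.2 ^ (-(δ / 2)) * (R ^ δ / (4 * γ))⁻¹) ^ (-A))
      (((gammaMeasure ℓ 1).prod (gammaMeasure 1 1)).prod
        (volume.restrict (Set.Ioo (0 : ℝ) 1))) := by
    refine (integrable_const (1 : ℝ)).mono' hm.aestronglyMeasurable ?_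
    filter_upwards [hpos] with p hp
    obtain ⟨a, b, c⟩ := hp
    have h : 0 ≤ p.1.1 * p.1.2 * p.2 ^ (-(δ / 2)) * (R ^ δ / (4 * γ))⁻¹ := by positivity
    rw [Real.norm_of_nonneg (by positivity)]
    exact Real.rpow_le_one_of_one_le_of_nonpos (by linarith) (by linarith)
  have h2 : ∀ u ∈ Set.Ioo (0 : ℝ) 1,
      ∫ p : ℝ × ℝ, (1 + p.1 * p.2 * u ^ (-(δ / 2)) * (R ^ δ / (4 * γ))⁻¹) ^ (-A)
        ∂((gammaMeasure ℓ 1).prod (gammaMeasure 1 1)) =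
      attenuatedMean A ℓ γ δ (Real.sqrt (R ^ 2 * u)) := fun u hu => by
    rw [attenuatedMean, powerGainLaw, integral_map (by fun_prop)
      (Measurable.aestronglyMeasurable (by fun_prop))]
    congr 1
    ext p
    have e1 : Real.sqrt (R ^ 2 * u) ^ δ = R ^ δ * u ^ (δ / 2) := by
      rw [Real.sqrt_mul (by positivity), Real.sqrt_sq hR.le,
        Real.mul_rpow hR.le (Real.sqrt_nonneg u), Real.sqrt_eq_rpow, ← Real.rpow_mul hu.1.le]
      ring_nf
    rw [e1, Real.rpow_neg hu.1.le]
    have := Real.rpow_pos_of_pos hu.1 (δ / 2)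
    have := Real.rpow_pos_of_pos hR δ
    congr 2
    field_simp
  rw [h1, integral_prod_symm _ hI2, setIntegral_congr_fun measurableSet_Ioo h2,
    ← integral_Ioc_eq_integral_Ioo, ← intervalIntegral.integral_of_le zero_le_one,
    intervalIntegral.integral_comp_mul_left (fun v => attenuatedMean A ℓ γ δ (Real.sqrt v))
      (by positivity : R ^ 2 ≠ 0)]
  simp only [mul_zero, mul_one, smul_eq_mul]
  field_simp

end Attenuated

end

/-! ### Assembly of the effective rate. -/

noncomputable section

theorem snr_eq {L : ℕ} (P σ δ dSR dRD : ℝ) (h g ε : Fin L → ℝ) :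
    snr P σ δ dSR dRD h g ε = P / σ ^ 2 / dSR ^ δ *
      ‖reflectedSum (Sum.elim h (Sum.elim g ε))‖ ^ 2 / dRD ^ δ := by
  simp only [snr, reflectedSum, Sum.elim_inl, Sum.elim_inr, div_eq_mul_inv, mul_inv]
  ring

theorem integral_one_add_rpow_neg_ring {Ω : Type*} [MeasurableSpace Ω] {μ : Measure Ω}
    [IsProbabilityMeasure μ] {O : EuclideanSpace ℝ (Fin 2)} {R₁ R₂ A ℓ γ δ : ℝ}
    (hR₁ : 0 < R₁) (hR : R₁ < R₂) (hA : 0 < A) (hℓ : 0 < ℓ) (hγ : 0 < γ)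
    {Z : Ω → ℝ} {D : Ω → EuclideanSpace ℝ (Fin 2)} (hZ : HasLaw Z (powerGainLaw ℓ) μ)
    (hD : HasLaw D (ProbabilityTheory.cond volume (planarRing O R₁ R₂)) μ)
    (hind : IndepFun Z D μ) :
    Integrable (fun ω => (1 + γ * Z ω / dist O (D ω) ^ δ) ^ (-A)) μ ∧
    ∫ ω, (1 + γ * Z ω / dist O (D ω) ^ δ) ^ (-A) ∂μ =
      (R₂ ^ 2 - R₁ ^ 2)⁻¹ *
        ∫ v in (R₁ ^ 2)..(R₂ ^ 2), attenuatedMean A ℓ γ δ (Real.sqrt v) := by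
  have i1 := isProbabilityMeasure_powerGainLaw hℓ
  have i2 := isProbabilityMeasure_cond_planarRing O hR₁ hR
  have hlaw := hind.hasLaw_prod hZ hD
  have hm : Measurable fun p : ℝ × EuclideanSpace ℝ (Fin 2) =>
      (1 + γ * p.1 / dist O p.2 ^ δ) ^ (-A) := by fun_prop
  have hI : Integrable (fun p : ℝ × EuclideanSpace ℝ (Fin 2) =>
      (1 + γ * p.1 / dist O p.2 ^ δ) ^ (-A)) ((powerGainLaw ℓ).prod
      (ProbabilityTheory.cond volume (planarRing O R₁ R₂))) := by
    refine (integrable_const (1 : ℝ)).mono' hm.aestronglyMeasurable ?_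
    have h5 := Measure.quasiMeasurePreserving_fst (μ := powerGainLaw ℓ)
      (ν := ProbabilityTheory.cond volume (planarRing O R₁ R₂))
    filter_upwards [h5.ae (ae_pos_powerGainLaw hℓ)] with p hp
    exact norm_one_add_div_rpow_neg_le_one hA hγ hp.le dist_nonneg
  constructor
  · rw [← hlaw.map_eq] at hI
    exact hI.comp_aemeasurable hlaw.aemeasurable
  · have h := hlaw.integral_comp hm.aestronglyMeasurable
    rw [integral_prod_symm _ hI] at h
    rw [← integral_cond_planarRing_dist O hR₁ hR (attenuatedMean A ℓ γ δ)]
    exact h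

end

theorem proposition2
    {Ω : Type*} [MeasurableSpace Ω] (μ : Measure Ω) [IsProbabilityMeasure μ]
    -- number of reflecting elements, transmit power, noise level, path-loss exponent,
    -- distance from the source to the surface
    (L : ℕ) (hL : 1 ≤ L) (P σ δ dSR : ℝ) (hP : 0 < P) (hσ : 0 < σ) (hδ : 0 < δ) (hdSR : 0 < dSR)
    -- the ring around the position `O` of the surface
    (O : EuclideanSpace ℝ (Fin 2)) (R₁ R₂ : ℝ) (hR₁ : 0 < R₁) (hR : R₁ < R₂)
    -- decay rate of the buffer occupancy, block length, bandwidth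
    (θ T B : ℝ) (hθ : 0 < θ) (hT : 0 < T) (hB : 0 < B)
    -- fading amplitudes, phase errors, position of the destination
    (h g ε : Fin L → Ω → ℝ) (D : Ω → EuclideanSpace ℝ (Fin 2))
    (hh : ∀ l, HasLaw (h l) (rayleighMeasure 1) μ)
    (hg : ∀ l, HasLaw (g l) (rayleighMeasure 1) μ)
    (hε : ∀ l, HasLaw (ε l) (cond volume (Set.Ioo (-Real.pi) Real.pi)) μ)
    (hD : HasLaw D (cond volume (planarRing O R₁ R₂)) μ)
    -- all of them are mutually independent
    (hindep : iIndepFun (Sum.elim h (Sum.elim g ε)) μ)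
    (hindepD : IndepFun (fun ω i => Sum.elim h (Sum.elim g ε) i ω) D μ)
    (A : ℝ) (hA : A = θ * T * B / Real.log 2)
    (γbar : ℝ) (hγbar : γbar = P / σ ^ 2 / dSR ^ δ)
    (γD : Ω → ℝ)
    (hγD : ∀ ω, γD ω = snr P σ δ dSR (dist O (D ω)) (fun l => h l ω) (fun l => g l ω)
      (fun l => ε l ω))
    -- the parameters of the two Meijer functions
    (a : Fin 2 → ℂ) (ha : a = ![-2 / (δ : ℂ), 0])
    (b : Fin 4 → ℂ) (hb : b = ![(L : ℂ) - 1, 0, (A : ℂ) - 1, -1 - 2 / (δ : ℂ)]) :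
    -- the expectation in the effective rate and the two Meijer functions are well defined
    Integrable (fun ω => (1 + γD ω) ^ (-A)) μ ∧
    IsMeijerG 3 2 a b ((R₁ ^ δ / (4 * γbar) : ℝ) : ℂ)
      (meijerG 3 2 a b ((R₁ ^ δ / (4 * γbar) : ℝ) : ℂ)) ∧
    IsMeijerG 3 2 a b ((R₂ ^ δ / (4 * γbar) : ℝ) : ℂ)
      (meijerG 3 2 a b ((R₂ ^ δ / (4 * γbar) : ℝ) : ℂ)) ∧
    ∃ W : ℝ,
      (W : ℂ) =
        ((R₂ ^ (2 + δ) : ℝ) : ℂ) * meijerG 3 2 a b ((R₂ ^ δ / (4 * γbar) : ℝ) : ℂ) -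
        ((R₁ ^ (2 + δ) : ℝ) : ℂ) * meijerG 3 2 a b ((R₁ ^ δ / (4 * γbar) : ℝ) : ℂ) ∧
      0 < W / (2 * δ * γbar * Real.Gamma L * Real.Gamma A * (R₂ ^ 2 - R₁ ^ 2)) ∧
      effectiveRate μ A γD =
        -(1 / A) * Real.logb 2
          (W / (2 * δ * γbar * Real.Gamma L * Real.Gamma A * (R₂ ^ 2 - R₁ ^ 2))) := by
  have hℓ1 : (1 : ℝ) ≤ L := by exact_mod_cast hL
  have hℓ0 : (0 : ℝ) < L := by linarith
  have hA0 : 0 < A := by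
    rw [hA]
    have := Real.log_pos one_lt_two
    positivity
  have hγ0 : 0 < γbar := by
    rw [hγbar]
    positivity
  have hR₂ : 0 < R₂ := hR₁.trans hR
  have hlaw : HasLaw (fun ω i => Sum.elim h (Sum.elim g ε) i ω) (Measure.pi (fadingLaw L)) μ := by
    refine hindep.hasLaw_pi fun i => ?_
    rcases i with i | i | i
    · exact hh i
    · exact hg i
    · exact hε i
  have hm : Measurable fun q : Fin L ⊕ Fin L ⊕ Fin L → ℝ => ‖reflectedSum q‖ ^ 2 := by
    have := measurable_reflectedSum (L := L)
    fun_prop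
  have hZ : HasLaw (fun ω => ‖reflectedSum (fun i => Sum.elim h (Sum.elim g ε) i ω)‖ ^ 2)
      (powerGainLaw L) μ :=
    HasLaw.fun_comp ⟨hm.aemeasurable, map_norm_sq_reflectedSum_pi hL⟩ hlaw
  have hind : IndepFun (fun ω => ‖reflectedSum (fun i => Sum.elim h (Sum.elim g ε) i ω)‖ ^ 2) D μ :=
    hindepD.comp hm measurable_id
  have hγD' : γD = fun ω => γbar *
      ‖reflectedSum (fun i => Sum.elim h (Sum.elim g ε) i ω)‖ ^ 2 / dist O (D ω) ^ δ := by
    ext ω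
    rw [hγD ω, snr_eq, ← hγbar]
    congr 4
  obtain ⟨hI, hE⟩ := integral_one_add_rpow_neg_ring (δ := δ) hR₁ hR hA0 hℓ0 hγ0 hZ hD hind
  have hpos : 0 < ∫ ω, (1 + γD ω) ^ (-A) ∂μ := by
    have hγnn : ∀ ω, 0 < 1 + γD ω := fun ω => by
      rw [hγD']
      positivity
    -- The integrand is strictly positive at every `ω`, so its support has full measure.
    rw [integral_pos_iff_support_of_nonneg (fun ω => (Real.rpow_pos_of_pos (hγnn ω) _).le)
      (by rw [hγD']; exact hI)]
    have : Function.support (fun ω => (1 + γD ω) ^ (-A)) = Set.univ :=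
      Set.eq_univ_of_forall fun ω => (Real.rpow_pos_of_pos (hγnn ω) _).ne'
    rw [this]
    simp
  have hM : ∀ R : ℝ, 0 < R → IsMeijerG 3 2 a b ((R ^ δ / (4 * γbar) : ℝ) : ℂ)
      (((R ^ δ / (4 * γbar))⁻¹ * (δ / 2) * (Real.Gamma A * Real.Gamma L) *
        ∫ p, Real.exp (-(mixedProduct (δ / 2) p * (R ^ δ / (4 * γbar))⁻¹))
          ∂(gammaUniformMeasure A L) : ℝ) : ℂ) := fun R hR0 => by
    rw [ha, hb]
    exact isMeijerG_laplace hℓ1 hA0 hδ (by positivity)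
  -- The inverse argument `4γ / R^δ` absorbs `R^δ`, leaving `R²`, and `4γ · δ/2` is the constant
  -- `2δγ`.
  have hscale : ∀ R : ℝ, 0 < R → R ^ (2 + δ) * ((R ^ δ / (4 * γbar))⁻¹ * (δ / 2) *
      (Real.Gamma A * Real.Gamma L) *
        ∫ p, Real.exp (-(mixedProduct (δ / 2) p * (R ^ δ / (4 * γbar))⁻¹))
          ∂(gammaUniformMeasure A L)) = 2 * δ * γbar * Real.Gamma L * Real.Gamma A *
        ∫ v in (0 : ℝ)..(R ^ 2), attenuatedMean A L γbar δ (Real.sqrt v) := fun R hR0 => by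
    rw [← integral_exp_neg_mixedProduct hA0 hℓ0 hγ0 hR0, Real.rpow_add hR0, Real.rpow_two]
    have := Real.rpow_pos_of_pos hR0 δ
    field_simp
    ring
  have hint := fun x y => intervalIntegrable_attenuatedMean_sqrt (δ := δ) hA0 hℓ0 hγ0 x y
  refine ⟨by rw [hγD']; exact hI, ?_, ?_, ?_⟩
  · rw [(hM R₁ hR₁).meijerG_eq]
    exact hM R₁ hR₁
  · rw [(hM R₂ hR₂).meijerG_eq]
    exact hM R₂ hR₂
  · have hW : 2 * δ * γbar * Real.Gamma L * Real.Gamma A *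
        (∫ v in (R₁ ^ 2)..(R₂ ^ 2), attenuatedMean A L γbar δ (Real.sqrt v)) /
        (2 * δ * γbar * Real.Gamma L * Real.Gamma A * (R₂ ^ 2 - R₁ ^ 2)) =
        ∫ ω, (1 + γD ω) ^ (-A) ∂μ := by
      rw [hγD', hE]
      have := (Real.Gamma_pos_of_pos hA0).ne'
      have := (Real.Gamma_pos_of_pos hℓ0).ne'
      have := (sq_sub_sq_pos_of_lt hR₁ hR).ne'
      field_simp
    -- By `hscale` the two Meijer terms are this constant times integrals over `(0, R₂²)` and `(0,
    -- R₁²)`; their difference is the integral over the ring.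
    refine ⟨2 * δ * γbar * Real.Gamma L * Real.Gamma A *
        ∫ v in (R₁ ^ 2)..(R₂ ^ 2), attenuatedMean A L γbar δ (Real.sqrt v), ?_, ?_, ?_⟩
    · rw [(hM R₁ hR₁).meijerG_eq, (hM R₂ hR₂).meijerG_eq, ← Complex.ofReal_mul,
        ← Complex.ofReal_mul, ← Complex.ofReal_sub, hscale R₁ hR₁, hscale R₂ hR₂, ← mul_sub,
        intervalIntegral.integral_interval_sub_left (hint _ _) (hint _ _)]
    · rw [hW]
      exact hpos
    · rw [effectiveRate, hW]
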